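/- Let $n\ge 1$. A cube in $\mathbb R^n$ is a half-open cube $Q=\prod_{i=1}^n[a_i,a_i+h)$, $h>0$. A family $\mathcal S$ of cubes is $\eta$-sparse, $0<\eta<1$, if for every $Q\in\mathcal S$ there is a measurable set $E_Q\subset Q$ with $|E_Q|\ge\eta|Q|$ such that the sets $E_Q$, $Q\in\mathcal S$, are pairwise disjoint. For $g\ge 0$ put $\mathcal A_{\mathcal S}g(x)=\sum_{Q\in\mathcal S}\Big(\frac1{|Q|}\int_Q g\Big)\chi_Q(x)\in[0,\infty]$. Let $\omega:[0,1]\to[0,\infty)$ be a modulus of continuity, that is, $\omega$ is nondecreasing and subadditive and $\omega(0)=0$. A bounded linear operator $T$ on $L^2(\mathbb R^n)$ (real or complex scalars) is an $\omega$-Calderón–Zygmund operator with kernel $K$ and size constant $C_K$ if, for every $f\in L^2(\mathbb R^n)$, $$Tf(x)=\int_{\mathbb R^n}K(x,y)f(y)\,dy\quad\text{for a.e. }x\notin\operatorname{supp}f,$$ where $|K(x,y)|\le C_K|x-y|^{-n}$ for $x\ne y$ and $$|K(x,y)-K(x',y)|+|K(y,x)-K(y,x')|\le\omega\Big(\frac{|x-x'|}{|x-y|}\Big)\frac1{|x-y|^n}\quad\text{for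 }|x-y|>2|x-x'|.$$ The modulus $\omega$ satisfies the Dini condition if $\|\omega\|_{\rm Dini}=\int_0^1\omega(t)\frac{dt}t<\infty$. **Theorem.** There are constants $c_n>0$ and $\eta_n\in(0,1)$, depending only on $n$, such that the following holds. Let $T$ be an $\omega$-Calderón–Zygmund operator with kernel $K$ and size constant $C_K$, where $\omega$ satisfies the Dini condition. Then, for every compactly supported $f\in L^1(\mathbb R^n)$, $Tf$ is well defined, as the measurable function, unique up to null sets, such that $Tu_k\to Tf$ in measure for every sequence $u_k\in L^1\cap L^2$ with $u_k\to f$ in $L^1$; and there is an $\eta_n$-sparse family $\mathcal S$ of cubes such that for a.e. $x\in\mathbb R^n$ $$|Tf(x)|\le c_n\big(\|T\|_{L^2\to L^2}+C_K+\|\omega\|_{\rm Dini}\big)\,\mathcal A_{\mathcal S}|f|(x).$$ -/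

import Mathlib

open MeasureTheory Filter Topology
open scoped ENNReal

/-- The half-open cube `∏ i, [a i, a i + h)` in `ℝⁿ`. -/
def halfOpenCube {n : ℕ} (a : EuclideanSpace ℝ (Fin n)) (h : ℝ) :
    Set (EuclideanSpace ℝ (Fin n)) :=
  {x | ∀ i, a i ≤ x i ∧ x i < a i + h}

/-- `Q` is a half-open cube with positive side length and sides parallel to the axes. -/
def IsCube {n : ℕ} (Q : Set (EuclideanSpace ℝ (Fin n))) : Prop :=
  ∃ (a : EuclideanSpace ℝ (Fin n)) (h : ℝ), 0 < h ∧ Q = halfOpenCube a h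

/-- `S` is an `η`-sparse family of cubes: each `Q ∈ S` has a measurable subset `E Q` with
`|E Q| ≥ η |Q|`, and the sets `E Q`, `Q ∈ S`, are pairwise disjoint. -/
def IsSparse {n : ℕ} (η : ℝ) (S : Set (Set (EuclideanSpace ℝ (Fin n)))) : Prop :=
  (∀ Q ∈ S, IsCube Q) ∧
  ∃ E : Set (EuclideanSpace ℝ (Fin n)) → Set (EuclideanSpace ℝ (Fin n)),
    (∀ Q ∈ S, MeasurableSet (E Q) ∧ E Q ⊆ Q ∧ ENNReal.ofReal η * volume Q ≤ volume (E Q)) ∧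
    S.PairwiseDisjoint E

/-- The sparse operator `A_S f (x) = ∑_{Q ∈ S} f_Q χ_Q(x)` on nonnegative functions `f`, where
`f_Q` is the average of `f` over `Q`; the sum is taken in `[0, ∞]`. -/
noncomputable def sparseOperator {n : ℕ} (S : Set (Set (EuclideanSpace ℝ (Fin n))))
    (f : EuclideanSpace ℝ (Fin n) → ℝ≥0∞) (x : EuclideanSpace ℝ (Fin n)) : ℝ≥0∞ :=
  ∑' Q : S, (Q : Set (EuclideanSpace ℝ (Fin n))).indicator
    (fun _ => ⨍⁻ y in (Q : Set (EuclideanSpace ℝ (Fin n))), f y ∂volume) x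

/-- A modulus of continuity on `[0, 1]`: nondecreasing, subadditive, zero at zero (hence
nonnegative). Only the values of `ω` on `[0, 1]` matter. -/
structure IsModulusOfContinuity (ω : ℝ → ℝ) : Prop where
  zero : ω 0 = 0
  mono : MonotoneOn ω (Set.Icc 0 1)
  subadd : ∀ s t : ℝ, 0 ≤ s → 0 ≤ t → s + t ≤ 1 → ω (s + t) ≤ ω s + ω t

/-- The Dini condition `∫₀¹ ω(t) dt/t < ∞`. -/
def DiniCondition (ω : ℝ → ℝ) : Prop :=
  IntegrableOn (fun t => ω t / t) (Set.Ioc 0 1) volume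

/-- The Dini norm `∫₀¹ ω(t) dt/t`. -/
noncomputable def diniNorm (ω : ℝ → ℝ) : ℝ :=
  ∫ t in Set.Ioc (0 : ℝ) 1, ω t / t

/-- The bounded linear operator `T` on `L²(ℝⁿ)` is an `ω`-Calderón–Zygmund operator with
kernel `K` and size constant `CK`. The values of `K` on the diagonal are irrelevant. -/
structure IsCalderonZygmund {n : ℕ} {𝕜 : Type*} [RCLike 𝕜]
    (T : Lp 𝕜 2 (volume : Measure (EuclideanSpace ℝ (Fin n))) →L[𝕜]
      Lp 𝕜 2 (volume : Measure (EuclideanSpace ℝ (Fin n))))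
    (K : EuclideanSpace ℝ (Fin n) → EuclideanSpace ℝ (Fin n) → 𝕜)
    (CK : ℝ) (ω : ℝ → ℝ) : Prop where
  modulus : IsModulusOfContinuity ω
  /-- `Tf(x) = ∫ K(x,y) f(y) dy` off the support of `f`; as `Tf` is an `L²` class, this is
  required for almost every such `x`. -/
  representation : ∀ (f : EuclideanSpace ℝ (Fin n) → 𝕜) (hf : MemLp f 2 volume),
    ∀ᵐ x ∂volume, x ∉ tsupport f → T (hf.toLp f) x = ∫ y, K x y * f y
  size : ∀ x y, x ≠ y → ‖K x y‖ ≤ CK / ‖x - y‖ ^ n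
  smoothness : ∀ x x' y, 2 * ‖x - x'‖ < ‖x - y‖ →
    ‖K x y - K x' y‖ + ‖K y x - K y x'‖ ≤ ω (‖x - x'‖ / ‖x - y‖) * (1 / ‖x - y‖ ^ n)

/-- `g` is (a representative of) `Tf` for `f ∈ L¹(ℝⁿ)`, where `T` is a bounded operator on `L²`,
extended to `L¹` by continuity from `L¹` to convergence in measure: `T u_k → g` in measure
whenever `u_k ∈ L¹ ∩ L²` and `u_k → f` in `L¹`. Such a `g` is unique up to null sets, and it is
`Tf` if `f` is in `L¹ ∩ L²`. -/
def IsL1Extension {n : ℕ} {𝕜 : Type*} [RCLike 𝕜]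
    (T : Lp 𝕜 2 (volume : Measure (EuclideanSpace ℝ (Fin n))) →L[𝕜]
      Lp 𝕜 2 (volume : Measure (EuclideanSpace ℝ (Fin n))))
    (f g : EuclideanSpace ℝ (Fin n) → 𝕜) : Prop :=
  AEStronglyMeasurable g volume ∧
  ∀ u : ℕ → Lp 𝕜 2 (volume : Measure (EuclideanSpace ℝ (Fin n))),
    (∀ k, Integrable (u k) volume) →
    Tendsto (fun k => eLpNorm (fun x => u k x - f x) 1 volume) atTop (𝓝 0) →
    TendstoInMeasure volume (fun k => (T (u k) : EuclideanSpace ℝ (Fin n) → 𝕜)) atTop g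

/-! Write q* for `dilate (4 * n) q`. The sparse family comes from a stopping time. For each dyadic
cube q one selects disjoint dyadic subcubes `ch q`, of at most half the measure of q, such that
almost everywhere on q off these subcubes |T(fχ_{q*})| is at most C times the average of |f| over
q*, and on each p in `ch q` it is at most that average term plus |T(fχ_{p*})|. Iteration turns this
into the sparse sum, because almost every point lies in finitely many generations. The sets q \ ⋃
`ch q` witness sparseness. The iteration starts from a partition of ℝⁿ into dyadic cubes q whose
dilates contain supp f, so that T(fχ_{q*}) = Tf.

The selection is `IsCalderonZygmund.exists_descendants`. Let Ω ⊂ q be the set where |T(fχ_{q*})| is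
large or which meets a dilated stopping cube of |f|χ_{q*}; then `ch q` consists of the maximal
dyadic cubes in which Ω has density above a threshold. On p in `ch q` the difference of T(fχ_{q*})
and T(fχ_{p*}) is T(fχ_{q* \ p*}). By smoothness of the kernel, its oscillation on p is at most the
Dini norm times the averages of |f| over the dilated ancestors of p (`ae_enorm_extension_le`), and
these are bounded since p contains a point off Ω. So it is enough to bound it at one point z of p:
off Ω the first term is small, and by the weak type inequality the second is small on three quarters
of p. No maximal truncation of T is needed, only its weak type (1,1).

The weak type inequality (`weak_type`) comes from the Calderón–Zygmund decomposition. It also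
extends T to L¹ by convergence in measure (`HasWeakType.exists_isL1Extension`). -/

/-- The index of the dyadic cube of side length `2 ^ k` that contains `x`. -/
noncomputable def gridIndex {n : ℕ} (k : ℤ) (x : EuclideanSpace ℝ (Fin n)) (i : Fin n) : ℤ :=
  ⌊x i / (2 : ℝ) ^ k⌋

/-- The dyadic cube with index `q = (k, a)`, that is `∏ i, [a i * 2 ^ k, (a i + 1) * 2 ^ k)`. -/
def dyadicCube {n : ℕ} (q : ℤ × (Fin n → ℤ)) : Set (EuclideanSpace ℝ (Fin n)) :=
  {x | gridIndex q.1 x = q.2}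

/-- The union of the dyadic cubes of the same side length as the cube `q` whose index differs from
that of `q` by at most `m` in each coordinate. -/
def dilate {n : ℕ} (m : ℕ) (q : ℤ × (Fin n → ℤ)) : Set (EuclideanSpace ℝ (Fin n)) :=
  {x | ∀ i, |gridIndex q.1 x i - q.2 i| ≤ m}

/-- The index of the dyadic cube with side length `2 ^ j` times larger that contains cube `q`. -/
def ancestor {n : ℕ} (j : ℕ) (q : ℤ × (Fin n → ℤ)) : ℤ × (Fin n → ℤ) :=
  (q.1 + j, fun i => q.2 i / 2 ^ j)

/-! ### The dyadic grid: cubes, ancestors, dilates, differentiation. -/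

section Grid

variable {n : ℕ} {m : ℕ} {q p : ℤ × (Fin n → ℤ)} {x y z : EuclideanSpace ℝ (Fin n)} {k : ℤ}

lemma mem_dyadicCube : x ∈ dyadicCube q ↔ gridIndex q.1 x = q.2 := Iff.rfl

lemma mem_dyadicCube_gridIndex (k : ℤ) (x : EuclideanSpace ℝ (Fin n)) :
    x ∈ dyadicCube (k, gridIndex k x) := rfl

/-- Integer division by a positive number rounds down, so it agrees with nested floors for negative
indices too. -/
lemma gridIndex_add (k : ℤ) (j : ℕ) (x : EuclideanSpace ℝ (Fin n)) (i : Fin n) :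
    gridIndex (k + j) x i = gridIndex k x i / 2 ^ j := by
  unfold gridIndex
  have h := Int.floor_div_natCast (x i / (2 : ℝ) ^ k) (2 ^ j)
  rw [zpow_add₀ (by norm_num), ← div_div]
  push_cast at h
  simpa using h

lemma ancestor_gridIndex (k : ℤ) (j : ℕ) (x : EuclideanSpace ℝ (Fin n)) :
    ancestor j (k, gridIndex k x) = (k + j, gridIndex (k + j) x) := by
  refine Prod.ext rfl ?_
  funext i
  simp [ancestor, gridIndex_add]

lemma eq_of_mem_dyadicCube (h : x ∈ dyadicCube q) : q = (q.1, gridIndex q.1 x) :=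
  Prod.ext rfl h.symm

lemma mem_ancestor (j : ℕ) (h : x ∈ dyadicCube q) : x ∈ dyadicCube (ancestor j q) := by
  rw [eq_of_mem_dyadicCube h, ancestor_gridIndex]
  exact mem_dyadicCube_gridIndex _ _

lemma ancestor_ancestor (i j : ℕ) (q : ℤ × (Fin n → ℤ)) :
    ancestor i (ancestor j q) = ancestor (j + i) q := by
  refine Prod.ext (by simp [ancestor, add_assoc]) ?_
  funext l
  simp only [ancestor]
  rw [Int.ediv_ediv_of_nonneg (by positivity), pow_add]

lemma ancestor_zero (q : ℤ × (Fin n → ℤ)) : ancestor 0 q = q := by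
  refine Prod.ext (by simp [ancestor]) ?_
  funext l
  simp [ancestor]

lemma dyadicCube_subset_ancestor (j : ℕ) (q : ℤ × (Fin n → ℤ)) :
    dyadicCube q ⊆ dyadicCube (ancestor j q) := fun _ h => mem_ancestor j h

/-- The center of the dyadic cube with index `q`. -/
noncomputable def dyadicCenter (q : ℤ × (Fin n → ℤ)) : EuclideanSpace ℝ (Fin n) :=
  WithLp.toLp 2 fun i => ((q.2 i : ℝ) + 1 / 2) * 2 ^ q.1

lemma dyadicCenter_mem (q : ℤ × (Fin n → ℤ)) : dyadicCenter q ∈ dyadicCube q := by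
  rw [mem_dyadicCube]
  funext i
  have : (0 : ℝ) < 2 ^ q.1 := by positivity
  rw [gridIndex, Int.floor_eq_iff]
  simp only [dyadicCenter]
  rw [mul_div_assoc, div_self this.ne']
  constructor <;> linarith

/-- If two dyadic cubes meet, the larger is an ancestor of the smaller. -/
lemma eq_ancestor_of_mem (hp : x ∈ dyadicCube p) (hq : x ∈ dyadicCube q) (h : p.1 ≤ q.1) :
    q = ancestor (q.1 - p.1).toNat p := by
  conv_lhs => rw [eq_of_mem_dyadicCube hq]
  conv_rhs => rw [eq_of_mem_dyadicCube hp]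
  rw [ancestor_gridIndex]
  have : p.1 + ((q.1 - p.1).toNat : ℤ) = q.1 := by omega
  rw [this]

lemma eq_of_mem_of_fst_eq (hp : x ∈ dyadicCube p) (hq : x ∈ dyadicCube q) (h : p.1 = q.1) :
    p = q := by
  rw [eq_of_mem_dyadicCube hp, eq_of_mem_dyadicCube hq, h]

lemma dyadicCube_subset_dilate (m : ℕ) (q : ℤ × (Fin n → ℤ)) : dyadicCube q ⊆ dilate m q := by
  intro x hx i
  rw [mem_dyadicCube] at hx
  simp [hx]

/-- An index gap of at most m is at most m * 2 ^ j, and division by 2 ^ j brings this back to m. -/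
lemma dilate_subset_ancestor (m j : ℕ) (q : ℤ × (Fin n → ℤ)) :
    dilate m q ⊆ dilate m (ancestor j q) := by
  intro x hx i
  have h := hx i
  simp only [ancestor]
  rw [gridIndex_add]
  rw [abs_le] at h ⊢
  have hpos : (0 : ℤ) < 2 ^ j := by positivity
  have key : ∀ a b : ℤ, a ≤ b + m → a / 2 ^ j ≤ b / 2 ^ j + m := by
    intro a b hab
    have h1 : (m : ℤ) ≤ m * 2 ^ j := by
      have : (1 : ℤ) ≤ 2 ^ j := Int.add_one_le_iff.mpr hpos
      nlinarith [Int.natCast_nonneg m]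
    calc a / 2 ^ j ≤ (b + m * 2 ^ j) / 2 ^ j := Int.ediv_le_ediv hpos (by linarith)
      _ = b / 2 ^ j + m := Int.add_mul_ediv_right _ _ hpos.ne'
  have h1 := key _ _ (show gridIndex q.1 x i ≤ q.2 i + m by linarith [h.2])
  have h2 := key _ _ (show q.2 i ≤ gridIndex q.1 x i + m by linarith [h.1])
  constructor <;> linarith

lemma dilate_symm (hx : x ∈ dyadicCube p) (hy : y ∈ dyadicCube q) (h : p.1 = q.1)
    (hxq : x ∈ dilate m q) : y ∈ dilate m p := by
  intro i
  have := hxq i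
  rw [mem_dyadicCube] at hx hy
  rw [h, hy, ← hx, h, abs_sub_comm]
  exact this

lemma gridIndex_mul_le (k : ℤ) (x : EuclideanSpace ℝ (Fin n)) (i : Fin n) :
    (gridIndex k x i : ℝ) * 2 ^ k ≤ x i := by
  have : (0 : ℝ) < 2 ^ k := by positivity
  have := Int.floor_le (x i / (2 : ℝ) ^ k)
  rwa [le_div_iff₀ (by positivity)] at this

lemma lt_gridIndex_mul (k : ℤ) (x : EuclideanSpace ℝ (Fin n)) (i : Fin n) :
    x i < ((gridIndex k x i : ℝ) + 1) * 2 ^ k := by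
  have : (0 : ℝ) < 2 ^ k := by positivity
  have := Int.lt_floor_add_one (x i / (2 : ℝ) ^ k)
  rwa [div_lt_iff₀ (by positivity)] at this

lemma abs_apply_sub_le_norm (x y : EuclideanSpace ℝ (Fin n)) (i : Fin n) :
    |x i - y i| ≤ ‖x - y‖ := by
  simpa using PiLp.norm_apply_le (p := 2) (x - y) i

/-- Some coordinate has index gap at least m + 1, which leaves m full side lengths between the two
points. -/
lemma le_norm_sub_of_notMem_dilate (hx : x ∈ dyadicCube q) (hy : y ∉ dilate m q) :
    m * (2 : ℝ) ^ q.1 ≤ ‖x - y‖ := by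
  have h2 : (0 : ℝ) < 2 ^ q.1 := by positivity
  simp only [dilate, Set.mem_ofPred_eq, not_forall, not_le] at hy
  obtain ⟨i, hi⟩ := hy
  refine le_trans ?_ (abs_apply_sub_le_norm x y i)
  have hx' : gridIndex q.1 x i = q.2 i := congrFun hx i
  rw [← hx'] at hi
  have a1 := gridIndex_mul_le q.1 x i
  have a2 := lt_gridIndex_mul q.1 x i
  have a3 := gridIndex_mul_le q.1 y i
  have a4 := lt_gridIndex_mul q.1 y i
  rcases lt_abs.1 hi with h | h
  · have h' : (m : ℝ) + 1 + gridIndex q.1 x i ≤ gridIndex q.1 y i := by exact_mod_cast (by omega)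
    rw [abs_sub_comm]
    refine le_trans ?_ (le_abs_self _)
    nlinarith
  · have h' : (m : ℝ) + 1 + gridIndex q.1 y i ≤ gridIndex q.1 x i := by exact_mod_cast (by omega)
    refine le_trans ?_ (le_abs_self _)
    nlinarith

/-- The sharp factor is √n; using n keeps all later constants natural numbers. -/
lemma norm_sub_le_of_mem_dyadicCube (hx : x ∈ dyadicCube q) (hy : y ∈ dyadicCube q) :
    ‖x - y‖ ≤ n * (2 : ℝ) ^ q.1 := by
  have h2 : (0 : ℝ) < 2 ^ q.1 := by positivity
  have h : ∀ i, |x i - y i| ≤ 2 ^ q.1 := by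
    intro i
    have hx' : gridIndex q.1 x i = q.2 i := congrFun hx i
    have hy' : gridIndex q.1 y i = q.2 i := congrFun hy i
    have a1 := gridIndex_mul_le q.1 x i
    have a2 := lt_gridIndex_mul q.1 x i
    have a3 := gridIndex_mul_le q.1 y i
    have a4 := lt_gridIndex_mul q.1 y i
    rw [hx'] at a1 a2
    rw [hy'] at a3 a4
    rw [abs_le]
    constructor <;> nlinarith
  rw [EuclideanSpace.norm_eq]
  refine Real.sqrt_le_iff.2 ⟨by positivity, ?_⟩
  calc ∑ i, ‖(x - y) i‖ ^ 2 ≤ ∑ _i : Fin n, ((2 : ℝ) ^ q.1) ^ 2 := by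
        gcongr with i
        simpa using h i
    _ = n * ((2 : ℝ) ^ q.1) ^ 2 := by simp
    _ ≤ (n * (2 : ℝ) ^ q.1) ^ 2 := by
        rw [mul_pow]
        gcongr
        exact_mod_cast Nat.le_self_pow (by norm_num) n

lemma dilate_eq_halfOpenCube (m : ℕ) (q : ℤ × (Fin n → ℤ)) :
    dilate m q = halfOpenCube (WithLp.toLp 2 fun i => ((q.2 i : ℝ) - m) * 2 ^ q.1)
      ((2 * m + 1) * 2 ^ q.1) := by
  have h2 : (0 : ℝ) < 2 ^ q.1 := by positivity
  ext x
  simp only [dilate, halfOpenCube, Set.mem_ofPred_eq]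
  refine forall_congr' fun i => ?_
  have e1 : q.2 i - m ≤ gridIndex q.1 x i ↔ ((q.2 i : ℝ) - m) * 2 ^ q.1 ≤ x i := by
    rw [gridIndex, Int.le_floor, le_div_iff₀ h2]
    push_cast
    rfl
  have e2 : gridIndex q.1 x i < q.2 i + m + 1 ↔
      x i < ((q.2 i : ℝ) - m) * 2 ^ q.1 + (2 * m + 1) * 2 ^ q.1 := by
    rw [gridIndex, Int.floor_lt, div_lt_iff₀ h2]
    push_cast
    ring_nf
  rw [← e1, ← e2, abs_le]
  constructor <;> rintro ⟨h1, h3⟩ <;> constructor <;> omega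

lemma dilate_zero (q : ℤ × (Fin n → ℤ)) : dilate 0 q = dyadicCube q := by
  ext x
  simp [dilate, dyadicCube, funext_iff, sub_eq_zero]

lemma halfOpenCube_eq_preimage (a : EuclideanSpace ℝ (Fin n)) (h : ℝ) :
    halfOpenCube a h = (MeasurableEquiv.toLp 2 (Fin n → ℝ)).symm ⁻¹'
      (Set.univ.pi fun i => Set.Ico (a i) (a i + h)) := by
  ext x
  simp [halfOpenCube, Set.mem_pi]

lemma measurableSet_halfOpenCube (a : EuclideanSpace ℝ (Fin n)) (h : ℝ) :
    MeasurableSet (halfOpenCube a h) := by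
  rw [halfOpenCube_eq_preimage]
  exact (MeasurableEquiv.measurable _)
    (MeasurableSet.univ_pi fun i => measurableSet_Ico)

lemma volume_halfOpenCube (a : EuclideanSpace ℝ (Fin n)) (h : ℝ) :
    volume (halfOpenCube a h) = ENNReal.ofReal h ^ n := by
  rw [halfOpenCube_eq_preimage,
    (EuclideanSpace.volume_preserving_symm_measurableEquiv_toLp (Fin n)).measure_preimage
      (MeasurableSet.univ_pi fun i => measurableSet_Ico).nullMeasurableSet, Real.volume_pi_Ico]
  simp

lemma measurableSet_dilate (m : ℕ) (q : ℤ × (Fin n → ℤ)) : MeasurableSet (dilate m q) := by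
  rw [dilate_eq_halfOpenCube]
  exact measurableSet_halfOpenCube _ _

lemma measurableSet_dyadicCube (q : ℤ × (Fin n → ℤ)) : MeasurableSet (dyadicCube q) := by
  rw [← dilate_zero]
  exact measurableSet_dilate _ _

lemma volume_dyadicCube (q : ℤ × (Fin n → ℤ)) :
    volume (dyadicCube q) = ENNReal.ofReal (2 ^ q.1) ^ n := by
  rw [← dilate_zero, dilate_eq_halfOpenCube, volume_halfOpenCube]
  simp

lemma volume_dilate (m : ℕ) (q : ℤ × (Fin n → ℤ)) :
    volume (dilate m q) = (2 * m + 1) ^ n * volume (dyadicCube q) := by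
  rw [volume_dyadicCube, dilate_eq_halfOpenCube, volume_halfOpenCube,
    ENNReal.ofReal_mul (by positivity), mul_pow]
  congr 2
  rw [ENNReal.ofReal_add (by positivity) (by norm_num), ENNReal.ofReal_mul (by norm_num)]
  simp

lemma volume_dyadicCube_ne_zero (q : ℤ × (Fin n → ℤ)) : volume (dyadicCube q) ≠ 0 := by
  rw [volume_dyadicCube]
  have : (0 : ℝ) < 2 ^ q.1 := by positivity
  simp [this]

lemma volume_dyadicCube_ne_top (q : ℤ × (Fin n → ℤ)) : volume (dyadicCube q) ≠ ∞ := by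
  rw [volume_dyadicCube]
  exact ENNReal.pow_ne_top ENNReal.ofReal_ne_top

lemma volume_dilate_ne_zero (m : ℕ) (q : ℤ × (Fin n → ℤ)) : volume (dilate m q) ≠ 0 := by
  rw [volume_dilate]
  exact mul_ne_zero (by positivity) (volume_dyadicCube_ne_zero q)

lemma volume_dilate_ne_top (m : ℕ) (q : ℤ × (Fin n → ℤ)) : volume (dilate m q) ≠ ∞ := by
  rw [dilate_eq_halfOpenCube, volume_halfOpenCube]
  exact ENNReal.pow_ne_top ENNReal.ofReal_ne_top

lemma volume_ancestor (j : ℕ) (q : ℤ × (Fin n → ℤ)) :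
    volume (dyadicCube (ancestor j q)) = (2 ^ j) ^ n * volume (dyadicCube q) := by
  rw [volume_dyadicCube, volume_dyadicCube, ancestor, zpow_add₀ (by norm_num), mul_comm,
    ENNReal.ofReal_mul (by positivity), mul_pow]
  congr 2
  rw [zpow_natCast, ENNReal.ofReal_pow (by norm_num)]
  simp

lemma isCube_dilate (m : ℕ) (q : ℤ × (Fin n → ℤ)) : IsCube (dilate m q) :=
  ⟨_, _, by positivity, dilate_eq_halfOpenCube m q⟩

/-- The volume determines the scale, and the extreme corner cube determines the index. The sparse
operator sums over sets, so distinct indices must not collapse to one summand. -/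
lemma dilate_injective (hn : 0 < n) (m : ℕ) :
    Function.Injective (dilate m : ℤ × (Fin n → ℤ) → Set (EuclideanSpace ℝ (Fin n))) := by
  intro p q h
  have hv : volume (dyadicCube p) = volume (dyadicCube q) := by
    have := congrArg volume h
    rw [volume_dilate, volume_dilate] at this
    refine (ENNReal.mul_right_inj (by positivity) ?_).1 this
    exact ENNReal.pow_ne_top (by finiteness)
  have hk : p.1 = q.1 := by
    rw [volume_dyadicCube, volume_dyadicCube] at hv
    rw [← ENNReal.ofReal_pow (by positivity), ← ENNReal.ofReal_pow (by positivity),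
      ENNReal.ofReal_eq_ofReal_iff (by positivity) (by positivity)] at hv
    have h1 := (pow_left_inj₀ (by positivity) (by positivity) hn.ne').1 hv
    exact zpow_right_injective₀ (by norm_num) (by norm_num) h1
  have key : ∀ p q : ℤ × (Fin n → ℤ), p.1 = q.1 → dilate m p = dilate m q →
      ∀ i, q.2 i ≤ p.2 i := by
    intro p q hk h i
    have hmem := dyadicCenter_mem (p.1, fun i => p.2 i - (m : ℤ))
    set c := dyadicCenter (p.1, fun i => p.2 i - (m : ℤ))
    have hc : gridIndex p.1 c = fun i => p.2 i - (m : ℤ) := hmem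
    have : c ∈ dilate m p := by
      intro i
      simp [hc]
    rw [h] at this
    have := this i
    rw [← hk, hc, abs_le] at this
    simp only at this
    linarith [this.1]
  exact Prod.ext hk (funext fun i => le_antisymm (key _ _ hk.symm h.symm i) (key _ _ hk h i))

/-- Positivity of m matters: plain ancestors never leave their orthant, whereas dilated ones contain
balls of growing radius. -/
lemma exists_mem_dilate_ancestor (hm : 0 < m) (q : ℤ × (Fin n → ℤ))
    (y : EuclideanSpace ℝ (Fin n)) : ∃ j, y ∈ dilate m (ancestor j q) := by
  by_contra! h
  have h1 : ∀ j : ℕ, (2 : ℝ) ^ q.1 * j ≤ ‖dyadicCenter q - y‖ := by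
    intro j
    have := le_norm_sub_of_notMem_dilate (mem_ancestor j (dyadicCenter_mem q)) (h j)
    refine le_trans ?_ this
    have hm' : (1 : ℝ) ≤ m := by exact_mod_cast hm
    simp only [ancestor]
    rw [zpow_add₀ (by norm_num), zpow_natCast]
    have h2 : (j : ℝ) ≤ 2 ^ j := by exact_mod_cast Nat.lt_two_pow_self.le
    have h0 : (0 : ℝ) < 2 ^ q.1 := by positivity
    calc (2 : ℝ) ^ q.1 * j ≤ 2 ^ q.1 * 2 ^ j := by gcongr
      _ ≤ m * (2 ^ q.1 * 2 ^ j) := le_mul_of_one_le_left (by positivity) hm'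
  obtain ⟨j, hj⟩ := exists_nat_gt (‖dyadicCenter q - y‖ / (2 : ℝ) ^ q.1)
  rw [div_lt_iff₀ (by positivity)] at hj
  linarith [h1 j]

/-- This and the next lemma serve the kernel representation, which holds only off the closed
support. -/
lemma notMem_closure_dyadicCube (hm : 0 < m) (hx : x ∉ dilate m q) :
    x ∉ closure (dyadicCube q) := by
  intro h
  have h0 : (0 : ℝ) < m * 2 ^ q.1 := by positivity
  obtain ⟨y, hy, hxy⟩ := Metric.mem_closure_iff.1 h _ h0
  have := le_norm_sub_of_notMem_dilate hy hx
  rw [dist_eq_norm, norm_sub_rev] at hxy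
  linarith

lemma notMem_closure_compl_dilate (hm : 0 < m) (hx : x ∈ dyadicCube q) :
    x ∉ closure (dilate m q)ᶜ := by
  intro h
  have h0 : (0 : ℝ) < m * 2 ^ q.1 := by positivity
  obtain ⟨y, hy, hxy⟩ := Metric.mem_closure_iff.1 h _ h0
  have := le_norm_sub_of_notMem_dilate hx hy
  rw [dist_eq_norm] at hxy
  linarith

/-- **Lebesgue differentiation theorem** along dyadic cubes. -/
lemma ae_tendsto_lintegral_dyadicCube {φ : EuclideanSpace ℝ (Fin n) → ℝ≥0∞}
    (hφ : AEMeasurable φ) (hφ' : ∫⁻ x, φ x ≠ ∞) :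
    ∀ᵐ x, Tendsto (fun j : ℕ => (∫⁻ y in dyadicCube (-(j : ℤ), gridIndex (-(j : ℤ)) x), φ y) /
      volume (dyadicCube (-(j : ℤ), gridIndex (-(j : ℤ)) x))) atTop (𝓝 (φ x)) := by
  -- In the sup norm of `Fin n → ℝ`, dyadic cubes are balls up to a null boundary, so the
  -- differentiation theorem for doubling measures applies there.
  set e := (MeasurableEquiv.toLp 2 (Fin n → ℝ)).symm with he
  have hpres : MeasurePreserving e volume volume :=
    EuclideanSpace.volume_preserving_symm_measurableEquiv_toLp (Fin n)
  set ψ : (Fin n → ℝ) → ℝ≥0∞ := fun v => φ (e.symm v) with hψ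
  have hφψ : ∀ x, φ x = ψ (e x) := by simp [hψ]
  have hψm : AEMeasurable ψ := by
    refine hφ.comp_quasiMeasurePreserving ?_
    exact (hpres.symm e).quasiMeasurePreserving
  have hψi : ∫⁻ v, ψ v ≠ ∞ := by
    rw [← hpres.lintegral_comp_emb e.measurableEmbedding]
    simpa [hψ] using hφ'
  -- The parameter 1 admits balls that contain the point without being centred at it.
  have hdiff := (IsUnifLocDoublingMeasure.vitaliFamily (volume : Measure (Fin n → ℝ))
    1).ae_tendsto_lintegral_div hψm hψi
  have hdiff' := hpres.quasiMeasurePreserving.ae hdiff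
  filter_upwards [hdiff'] with x hx
  let w : ℕ → (Fin n → ℝ) := fun j => e (dyadicCenter (-(j : ℤ), gridIndex (-(j : ℤ)) x))
  let δ : ℕ → ℝ := fun j => 2 ^ (-(j : ℤ)) / 2
  have hδ : Tendsto δ atTop (𝓝[>] 0) := by
    refine tendsto_nhdsWithin_iff.2 ⟨?_, Eventually.of_forall fun j => ?_⟩
    · have : Tendsto (fun j : ℕ => ((1 : ℝ) / 2) ^ j / 2) atTop (𝓝 (0 / 2)) :=
        (tendsto_pow_atTop_nhds_zero_of_lt_one (by norm_num) (by norm_num)).div_const 2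
      rw [zero_div] at this
      refine this.congr fun j => ?_
      simp [δ]
    · simp only [Set.mem_Ioi, δ]
      positivity
  have hball : ∀ j : ℕ, Metric.closedBall (w j) (δ j) =ᵐ[volume]
      e.symm ⁻¹' dyadicCube (-(j : ℤ), gridIndex (-(j : ℤ)) x) := by
    intro j
    set q : ℤ × (Fin n → ℤ) := (-(j : ℤ), gridIndex (-(j : ℤ)) x) with hq
    have h1 : Metric.closedBall (w j) (δ j) =
        Set.univ.pi fun i => Set.Icc ((q.2 i : ℝ) * 2 ^ q.1) ((q.2 i : ℝ) * 2 ^ q.1 + 2 ^ q.1) := by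
      rw [closedBall_pi _ (by simp only [δ]; positivity)]
      congr 1
      funext i
      rw [Real.closedBall_eq_Icc]
      have : w j i = ((q.2 i : ℝ) + 1 / 2) * 2 ^ q.1 := rfl
      rw [this]
      simp only [δ]
      congr 1 <;> simp only [hq] <;> ring
    have h2 : e.symm ⁻¹' dyadicCube q = Set.univ.pi fun i =>
        Set.Ico ((q.2 i : ℝ) * 2 ^ q.1) ((q.2 i : ℝ) * 2 ^ q.1 + 2 ^ q.1) := by
      rw [← dilate_zero, dilate_eq_halfOpenCube, halfOpenCube_eq_preimage, ← Set.preimage_comp]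
      simp [e]
    rw [h1, h2]
    rw [Set.pi_univ_Icc]
    exact (Measure.univ_pi_Ico_ae_eq_Icc (μ := fun _ : Fin n => (volume : Measure ℝ))).symm
  have hmem : ∀ᶠ j in atTop, e x ∈ Metric.closedBall (w j) (1 * δ j) := by
    refine Eventually.of_forall fun j => ?_
    rw [one_mul, Metric.mem_closedBall, dist_pi_le_iff (by simp only [δ]; positivity)]
    intro i
    have h1 := gridIndex_mul_le (-(j : ℤ)) x i
    have h2 := lt_gridIndex_mul (-(j : ℤ)) x i
    have e1 : w j i = ((gridIndex (-(j : ℤ)) x i : ℝ) + 1 / 2) * 2 ^ (-(j : ℤ)) := rfl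
    have e2 : e x i = x i := rfl
    rw [Real.dist_eq, e1, e2, abs_le]
    simp only [δ]
    constructor <;> linarith
  have hlim := hx.comp (IsUnifLocDoublingMeasure.tendsto_closedBall_filterAt volume w δ hδ hmem)
  rw [hφψ x]
  refine hlim.congr fun j => ?_
  simp only [Function.comp_apply]
  rw [setLIntegral_congr (hball j), measure_congr (hball j)]
  rw [(hpres.symm e).measure_preimage (measurableSet_dyadicCube _).nullMeasurableSet]
  rw [(hpres.symm e).setLIntegral_comp_preimage_emb e.symm.measurableEmbedding]

end Grid

/-! ### Stopping cubes and the dyadic Calderón–Zygmund lemma. -/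

section Stopping

variable {n : ℕ} {φ : EuclideanSpace ℝ (Fin n) → ℝ≥0∞} {t : ℝ≥0∞} {q p : ℤ × (Fin n → ℤ)}

/-- The average of `φ` over the dyadic cube with index `q` exceeds `t`. -/
def IsHeavy (φ : EuclideanSpace ℝ (Fin n) → ℝ≥0∞) (t : ℝ≥0∞) (q : ℤ × (Fin n → ℤ)) : Prop :=
  t * volume (dyadicCube q) < ∫⁻ x in dyadicCube q, φ x

/-- The maximal dyadic cubes over which the average of `φ` exceeds `t`. -/
def stoppingCubes (φ : EuclideanSpace ℝ (Fin n) → ℝ≥0∞) (t : ℝ≥0∞) : Set (ℤ × (Fin n → ℤ)) :=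
  {q | IsHeavy φ t q ∧ ∀ j, ¬ IsHeavy φ t (ancestor (j + 1) q)}

/-- The total mass is finite while volumes of ancestors grow without bound, so there is a last heavy
ancestor. -/
lemma IsHeavy.exists_ancestor_mem_stoppingCubes (hn : 0 < n) (ht : t ≠ 0)
    (hφ : ∫⁻ x, φ x ≠ ∞) (hq : IsHeavy φ t q) : ∃ j, ancestor j q ∈ stoppingCubes φ t := by
  classical
  have hc : t * volume (dyadicCube q) ≠ 0 := mul_ne_zero ht (volume_dyadicCube_ne_zero q)
  obtain ⟨N, hN⟩ := ENNReal.exists_nat_mul_gt hc hφ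
  have hb : ∀ j, N ≤ j → ¬ IsHeavy φ t (ancestor j q) := by
    intro j hj h
    refine absurd (h.trans_le (setLIntegral_le_lintegral _ _)) (not_lt.2 (hN.le.trans ?_))
    have h1 : (N : ℝ≥0∞) ≤ (2 ^ j) ^ n := by
      have : N ≤ (2 ^ j) ^ n :=
        (hj.trans Nat.lt_two_pow_self.le).trans (Nat.le_self_pow hn.ne' _)
      exact_mod_cast this
    rw [volume_ancestor]
    calc (N : ℝ≥0∞) * (t * volume (dyadicCube q))
        ≤ (2 ^ j) ^ n * (t * volume (dyadicCube q)) := by gcongr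
      _ = t * ((2 ^ j) ^ n * volume (dyadicCube q)) := by ring
  have h0 : IsHeavy φ t (ancestor 0 q) := by rwa [ancestor_zero]
  refine ⟨Nat.findGreatest (fun j => IsHeavy φ t (ancestor j q)) N,
    Nat.findGreatest_spec (P := fun j => IsHeavy φ t (ancestor j q)) (Nat.zero_le N) h0, ?_⟩
  intro i
  rw [ancestor_ancestor]
  set g := Nat.findGreatest (fun j => IsHeavy φ t (ancestor j q)) N
  by_cases h : g + (i + 1) ≤ N
  · exact Nat.findGreatest_is_greatest (P := fun j => IsHeavy φ t (ancestor j q))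
      (by omega) h
  · exact hb _ (by omega)

lemma eq_of_mem_stoppingCubes {x : EuclideanSpace ℝ (Fin n)} (hp : p ∈ stoppingCubes φ t)
    (hq : q ∈ stoppingCubes φ t) (hxp : x ∈ dyadicCube p) (hxq : x ∈ dyadicCube q) : p = q := by
  have key : ∀ p q : ℤ × (Fin n → ℤ), p ∈ stoppingCubes φ t → q ∈ stoppingCubes φ t →
      x ∈ dyadicCube p → x ∈ dyadicCube q → p.1 ≤ q.1 → p = q := by
    intro p q hp hq hxp hxq h
    have e := eq_ancestor_of_mem hxp hxq h
    rcases Nat.eq_zero_or_pos (q.1 - p.1).toNat with h0 | h0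
    · rw [h0, ancestor_zero] at e
      exact e.symm
    · obtain ⟨d, hd⟩ := Nat.exists_eq_succ_of_ne_zero h0.ne'
      rw [hd] at e
      exact absurd (e ▸ hq.1) (hp.2 d)
  rcases le_total p.1 q.1 with h | h
  · exact key p q hp hq hxp hxq h
  · exact (key q p hq hp hxq hxp h).symm

lemma pairwiseDisjoint_stoppingCubes (φ : EuclideanSpace ℝ (Fin n) → ℝ≥0∞) (t : ℝ≥0∞) :
    (stoppingCubes φ t).PairwiseDisjoint dyadicCube := by
  intro p hp q hq hpq
  refine Set.disjoint_left.2 fun x hxp hxq => hpq ?_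
  exact eq_of_mem_stoppingCubes hp hq hxp hxq

lemma tsum_setLIntegral_dyadicCube {J : Set (ℤ × (Fin n → ℤ))}
    (hJ : J.PairwiseDisjoint dyadicCube) (φ : EuclideanSpace ℝ (Fin n) → ℝ≥0∞) :
    ∑' q : J, ∫⁻ x in dyadicCube (q : ℤ × (Fin n → ℤ)), φ x =
      ∫⁻ x in ⋃ q ∈ J, dyadicCube q, φ x :=
  (lintegral_biUnion (Set.to_countable J) (fun q _ => measurableSet_dyadicCube q) hJ φ).symm

lemma mul_tsum_volume_stoppingCubes_le (φ : EuclideanSpace ℝ (Fin n) → ℝ≥0∞) (t : ℝ≥0∞) :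
    t * ∑' q : stoppingCubes φ t, volume (dyadicCube (q : ℤ × (Fin n → ℤ))) ≤ ∫⁻ x, φ x := by
  rw [← ENNReal.tsum_mul_left]
  calc ∑' q : stoppingCubes φ t, t * volume (dyadicCube (q : ℤ × (Fin n → ℤ)))
      ≤ ∑' q : stoppingCubes φ t, ∫⁻ x in dyadicCube (q : ℤ × (Fin n → ℤ)), φ x :=
        ENNReal.tsum_le_tsum fun q => q.2.1.le
    _ = ∫⁻ x in ⋃ q ∈ stoppingCubes φ t, dyadicCube q, φ x :=
        tsum_setLIntegral_dyadicCube (pairwiseDisjoint_stoppingCubes φ t) φ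
    _ ≤ ∫⁻ x, φ x := setLIntegral_le_lintegral _ _

/-- By maximality the parent is not heavy, and its volume is 2 ^ n times larger. -/
lemma setLIntegral_le_of_mem_stoppingCubes (hq : q ∈ stoppingCubes φ t) :
    ∫⁻ x in dyadicCube q, φ x ≤ 2 ^ n * t * volume (dyadicCube q) := by
  have h := not_lt.1 (hq.2 0)
  rw [volume_ancestor] at h
  calc ∫⁻ x in dyadicCube q, φ x ≤ ∫⁻ x in dyadicCube (ancestor (0 + 1) q), φ x :=
        lintegral_mono_set (dyadicCube_subset_ancestor _ q)
    _ ≤ _ := h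
    _ = _ := by ring

/-- No dyadic cube around such a point is heavy, since its stopping ancestor would contain the
point; the averages, all at most t, converge to φ almost everywhere. -/
lemma ae_le_of_notMem_stoppingCubes (hn : 0 < n) (ht : t ≠ 0) (hφm : AEMeasurable φ)
    (hφ : ∫⁻ x, φ x ≠ ∞) :
    ∀ᵐ x, (∀ q ∈ stoppingCubes φ t, x ∉ dyadicCube q) → φ x ≤ t := by
  filter_upwards [ae_tendsto_lintegral_dyadicCube hφm hφ] with x hx hxq
  refine le_of_tendsto' hx fun j => ?_
  rw [ENNReal.div_le_iff (volume_dyadicCube_ne_zero _) (volume_dyadicCube_ne_top _)]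
  refine not_lt.1 fun h => ?_
  obtain ⟨i, hi⟩ := IsHeavy.exists_ancestor_mem_stoppingCubes hn ht hφ h
  exact hxq _ hi (mem_ancestor _ (mem_dyadicCube_gridIndex _ _))

end Stopping

/-! ### The Dini condition as a sum over dyadic scales. -/

section Dini

variable {n : ℕ} {ω : ℝ → ℝ}

lemma IsModulusOfContinuity.nonneg (hω : IsModulusOfContinuity ω) {t : ℝ} (h0 : 0 ≤ t)
    (h1 : t ≤ 1) : 0 ≤ ω t := by
  rw [← hω.zero]
  exact hω.mono ⟨le_rfl, zero_le_one⟩ ⟨h0, h1⟩ h0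

lemma diniNorm_nonneg (hω : IsModulusOfContinuity ω) : 0 ≤ diniNorm ω :=
  setIntegral_nonneg measurableSet_Ioc fun _ ht => div_nonneg (hω.nonneg ht.1.le ht.2) ht.1.le

/-- The dyadic sum of a modulus of continuity is controlled by its Dini norm. -/
lemma tsum_ofReal_modulus_le (hω : IsModulusOfContinuity ω) (hD : DiniCondition ω) :
    ∑' j : ℕ, ENNReal.ofReal (ω ((1 / 2) ^ (j + 1))) ≤ 2 * ENNReal.ofReal (diniNorm ω) := by
  have hI : ENNReal.ofReal (diniNorm ω) = ∫⁻ t in Set.Ioc (0 : ℝ) 1, ENNReal.ofReal (ω t / t) := by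
    refine ofReal_integral_eq_lintegral_ofReal hD ?_
    filter_upwards [ae_restrict_mem measurableSet_Ioc] with t ht
    exact div_nonneg (hω.nonneg ht.1.le ht.2) ht.1.le
  let s : ℕ → Set ℝ := fun j => Set.Ioc ((1 / 2) ^ (j + 1)) ((1 / 2) ^ j)
  have hanti : Antitone fun j : ℕ => ((1 : ℝ) / 2) ^ j :=
    pow_right_anti₀ (by norm_num) (by norm_num)
  have hs : Pairwise (Function.onFun Disjoint s) := by
    have := hanti.pairwise_disjoint_on_Ioc_succ
    simpa [s] using this
  have hsub : (⋃ j, s j) ⊆ Set.Ioc (0 : ℝ) 1 := by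
    refine Set.iUnion_subset fun j t ht => ⟨lt_of_le_of_lt (by positivity) ht.1, ht.2.trans ?_⟩
    exact pow_le_one₀ (by norm_num) (by norm_num)
  -- With a = 2^{-(j+1)}, monotonicity gives ω(t)/t ≥ ω(a)/(2a) on (a, 2a], an interval of length a;
  -- hence the factor 2.
  have hle : ∀ j : ℕ, ENNReal.ofReal (ω ((1 / 2) ^ (j + 1))) ≤
      2 * ∫⁻ t in s j, ENNReal.ofReal (ω t / t) := by
    intro j
    set a : ℝ := (1 / 2) ^ (j + 1) with ha
    have ha0 : 0 < a := by positivity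
    have ha1 : 2 * a ≤ 1 := by
      have : ((1 : ℝ) / 2) ^ j ≤ 1 := pow_le_one₀ (by norm_num) (by norm_num)
      rw [ha, pow_succ]
      linarith
    have hs' : s j = Set.Ioc a (2 * a) := by
      simp only [s, ha, pow_succ]
      congr 1
      ring
    have hωa : 0 ≤ ω a := hω.nonneg ha0.le (by linarith)
    have h1 : ∫⁻ _t in s j, ENNReal.ofReal (ω a / (2 * a)) ≤
        ∫⁻ t in s j, ENNReal.ofReal (ω t / t) := by
      refine setLIntegral_mono' (by simp only [s]; exact measurableSet_Ioc) fun t ht => ?_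
      rw [hs'] at ht
      refine ENNReal.ofReal_le_ofReal ?_
      have h2 : ω a ≤ ω t := hω.mono ⟨ha0.le, by linarith⟩
        ⟨ha0.le.trans ht.1.le, ht.2.trans ha1⟩ ht.1.le
      exact div_le_div₀ (hωa.trans h2) h2 (ha0.trans ht.1) ht.2
    refine le_trans (le_of_eq ?_) (mul_le_mul_right h1 2)
    rw [setLIntegral_const, hs', Real.volume_Ioc, ← ENNReal.ofReal_mul (by positivity),
      ← ENNReal.ofReal_ofNat 2, ← ENNReal.ofReal_mul (by norm_num)]
    congr 1
    field_simp
    ring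
  calc ∑' j : ℕ, ENNReal.ofReal (ω ((1 / 2) ^ (j + 1)))
      ≤ ∑' j, 2 * ∫⁻ t in s j, ENNReal.ofReal (ω t / t) := ENNReal.tsum_le_tsum hle
    _ = 2 * ∫⁻ t in ⋃ j, s j, ENNReal.ofReal (ω t / t) := by
        rw [ENNReal.tsum_mul_left, lintegral_iUnion (fun j => measurableSet_Ioc) hs]
    _ ≤ 2 * ENNReal.ofReal (diniNorm ω) := by
        rw [hI]
        gcongr

/-- Integration over the shells between consecutive dilated dyadic ancestors. -/
lemma lintegral_compl_dilate_mul_le (hω : IsModulusOfContinuity ω)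
    (hD : DiniCondition ω) {m : ℕ} (hm : 0 < m) {q : ℤ × (Fin n → ℤ)}
    {φ Φ : EuclideanSpace ℝ (Fin n) → ℝ≥0∞} {a : ℝ≥0∞}
    (hφ : ∀ j, ∫⁻ y in dilate m (ancestor j q), φ y ≤ a * volume (dilate m (ancestor j q)))
    (hΦ : ∀ (j : ℕ) (y : EuclideanSpace ℝ (Fin n)), y ∉ dilate m (ancestor j q) →
      Φ y ≤ ENNReal.ofReal (ω ((1 / 2) ^ (j + 1))) / volume (dyadicCube (ancestor j q))) :
    ∫⁻ y in (dilate m q)ᶜ, Φ y * φ y ≤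
      2 * (2 * (2 * m + 1)) ^ n * ENNReal.ofReal (diniNorm ω) * a := by
  let s : ℕ → Set (EuclideanSpace ℝ (Fin n)) := fun j =>
    dilate m (ancestor (j + 1) q) \ dilate m (ancestor j q)
  have hcover : (dilate m q)ᶜ ⊆ ⋃ j, s j := by
    classical
    intro y hy
    have hex := exists_mem_dilate_ancestor hm q y
    have h0 : Nat.find hex ≠ 0 := by
      intro h0
      have := Nat.find_spec hex
      rw [h0, ancestor_zero] at this
      exact hy this
    obtain ⟨j, hj⟩ := Nat.exists_eq_succ_of_ne_zero h0
    refine Set.mem_iUnion.2 ⟨j, ?_, Nat.find_min hex (by omega)⟩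
    have := Nat.find_spec hex
    rwa [hj] at this
  -- The bound on Φ comes from the inner dilate, the average of φ from the outer one, whose volume
  -- is (2(2m+1))^n times that of the j-th ancestor.
  have hshell : ∀ j, ∫⁻ y in s j, Φ y * φ y ≤
      (2 * (2 * m + 1)) ^ n * a * ENNReal.ofReal (ω ((1 / 2) ^ (j + 1))) := by
    intro j
    set w := ENNReal.ofReal (ω ((1 / 2) ^ (j + 1)))
    set v := volume (dyadicCube (ancestor j q))
    have hv0 : v ≠ 0 := volume_dyadicCube_ne_zero _
    have hvt : v ≠ ∞ := volume_dyadicCube_ne_top _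
    calc ∫⁻ y in s j, Φ y * φ y ≤ ∫⁻ y in s j, w / v * φ y := by
          refine setLIntegral_mono' ((measurableSet_dilate _ _).diff (measurableSet_dilate _ _))
            fun y hy => ?_
          gcongr
          exact hΦ j y hy.2
      _ = w / v * ∫⁻ y in s j, φ y :=
          lintegral_const_mul' _ _ (ENNReal.div_ne_top ENNReal.ofReal_ne_top hv0)
      _ ≤ w / v * ∫⁻ y in dilate m (ancestor (j + 1) q), φ y := by
          gcongr
          exact Set.sdiff_subset
      _ ≤ w / v * (a * volume (dilate m (ancestor (j + 1) q))) := by gcongr; exact hφ (j + 1)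
      _ = w / v * (a * ((2 * m + 1) ^ n * (2 ^ n * v))) := by
          rw [volume_dilate, ← ancestor_ancestor, volume_ancestor, pow_one]
      _ = (2 * (2 * m + 1)) ^ n * a * w * (v⁻¹ * v) := by
          rw [div_eq_mul_inv, mul_pow]
          ring
      _ = (2 * (2 * m + 1)) ^ n * a * w := by
          rw [ENNReal.inv_mul_cancel hv0 hvt, mul_one]
  calc ∫⁻ y in (dilate m q)ᶜ, Φ y * φ y ≤ ∫⁻ y in ⋃ j, s j, Φ y * φ y := lintegral_mono_set hcover
    _ ≤ ∑' j, ∫⁻ y in s j, Φ y * φ y := lintegral_iUnion_le _ _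
    _ ≤ ∑' j : ℕ, (2 * (2 * m + 1)) ^ n * a * ENNReal.ofReal (ω ((1 / 2) ^ (j + 1))) :=
        ENNReal.tsum_le_tsum hshell
    _ ≤ (2 * (2 * m + 1)) ^ n * a * (2 * ENNReal.ofReal (diniNorm ω)) := by
        rw [ENNReal.tsum_mul_left]
        gcongr
        exact tsum_ofReal_modulus_le hω hD
    _ = _ := by ring

end Dini

/-! ### Kernel smoothness on the dyadic grid. -/

section Kernel

variable {n : ℕ} {𝕜 : Type*} [RCLike 𝕜]
  {T : Lp 𝕜 2 (volume : Measure (EuclideanSpace ℝ (Fin n))) →L[𝕜]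
    Lp 𝕜 2 (volume : Measure (EuclideanSpace ℝ (Fin n)))}
  {K : EuclideanSpace ℝ (Fin n) → EuclideanSpace ℝ (Fin n) → 𝕜} {CK : ℝ} {ω : ℝ → ℝ}

/-- The smoothness of the kernel off a dilated dyadic cube. -/
lemma IsCalderonZygmund.enorm_kernel_sub_le (hT : IsCalderonZygmund T K CK ω) (hn : 0 < n)
    {q : ℤ × (Fin n → ℤ)} {x z : EuclideanSpace ℝ (Fin n)} (hx : x ∈ dyadicCube q)
    (hz : z ∈ dyadicCube q) (j : ℕ) {y : EuclideanSpace ℝ (Fin n)}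
    (hy : y ∉ dilate (4 * n) (ancestor j q)) :
    ‖K x y - K z y‖ₑ + ‖K y x - K y z‖ₑ ≤
      ENNReal.ofReal (ω ((1 / 2) ^ (j + 1))) / volume (dyadicCube (ancestor j q)) := by
  set r : ℝ := 2 ^ q.1 with hr
  have hr0 : 0 < r := by positivity
  have hn1 : (1 : ℝ) ≤ n := by exact_mod_cast hn
  have h1 : ‖x - z‖ ≤ n * r := norm_sub_le_of_mem_dyadicCube hx hz
  have h2 : 4 * n * (r * 2 ^ j) ≤ ‖x - y‖ := by
    have := le_norm_sub_of_notMem_dilate (mem_ancestor j hx) hy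
    simp only [ancestor] at this
    rw [zpow_add₀ (by norm_num), zpow_natCast] at this
    push_cast at this
    exact this
  have hj1 : (1 : ℝ) ≤ 2 ^ j := one_le_pow₀ (by norm_num)
  have hxy0 : 0 < ‖x - y‖ := lt_of_lt_of_le (by positivity) h2
  have h3 : 2 * ‖x - z‖ < ‖x - y‖ := by
    refine lt_of_lt_of_le ?_ h2
    have : n * r ≤ n * r * 2 ^ j := le_mul_of_one_le_right (by positivity) hj1
    nlinarith [mul_pos (lt_of_lt_of_le one_pos hn1) hr0]
  -- The distance is at least 4n · 2^j · r against a diameter of at most n · r, so the dilation by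
  -- 4n even leaves a factor 2 to spare.
  have h4 : ‖x - z‖ / ‖x - y‖ ≤ (1 / 2) ^ (j + 1) := by
    rw [div_le_iff₀ hxy0]
    calc ‖x - z‖ ≤ n * r := h1
      _ ≤ (1 / 2) ^ (j + 1) * (4 * n * (r * 2 ^ j)) := by
          rw [pow_succ, one_div, inv_pow]
          field_simp
          nlinarith
      _ ≤ _ := by gcongr
  have hle1 : ((1 : ℝ) / 2) ^ (j + 1) ≤ 1 := pow_le_one₀ (by norm_num) (by norm_num)
  have h5 : ω (‖x - z‖ / ‖x - y‖) ≤ ω ((1 / 2) ^ (j + 1)) :=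
    hT.modulus.mono ⟨by positivity, h4.trans hle1⟩ ⟨by positivity, hle1⟩ h4
  have h6 : (r * 2 ^ j) ^ n ≤ ‖x - y‖ ^ n := by
    gcongr
    refine le_trans ?_ h2
    exact le_mul_of_one_le_left (by positivity) (by linarith)
  have hω0 : 0 ≤ ω ((1 / 2) ^ (j + 1)) := hT.modulus.nonneg (by positivity) hle1
  have h7 := hT.smoothness x z y h3
  have hvol : volume (dyadicCube (ancestor j q)) = ENNReal.ofReal ((r * 2 ^ j) ^ n) := by
    rw [volume_dyadicCube, ENNReal.ofReal_pow (by positivity)]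
    simp only [ancestor]
    rw [zpow_add₀ (by norm_num), zpow_natCast]
  rw [hvol, ← ENNReal.ofReal_div_of_pos (by positivity), ← ofReal_norm, ← ofReal_norm,
    ← ENNReal.ofReal_add (norm_nonneg _) (norm_nonneg _)]
  refine ENNReal.ofReal_le_ofReal (h7.trans ?_)
  rw [mul_one_div]
  exact div_le_div₀ hω0 h5 (by positivity) h6

end Kernel

/-! ### Weak type (1,1) by the Calderón–Zygmund decomposition. -/

section WeakType

variable {n : ℕ} {𝕜 : Type*} [RCLike 𝕜]

/-- The finite part of the Calderón–Zygmund decomposition: finitely many stopping cubes suffice to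
make the square integral of `f` off these cubes small. -/
lemma exists_finset_stoppingCubes (hn : 0 < n) {φ : EuclideanSpace ℝ (Fin n) → ℝ≥0∞}
    (hφm : AEMeasurable φ) (h1 : ∫⁻ x, φ x ≠ ∞) (h2 : ∫⁻ x, φ x ^ 2 ≠ ∞) (h0 : ∫⁻ x, φ x ≠ 0)
    {t : ℝ≥0∞} (ht : t ≠ 0) :
    ∃ F : Finset (ℤ × (Fin n → ℤ)), (F : Set (ℤ × (Fin n → ℤ))) ⊆ stoppingCubes φ t ∧
      ∫⁻ x in (⋃ q ∈ F, dyadicCube q)ᶜ, φ x ^ 2 ≤ 2 * t * ∫⁻ x, φ x := by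
  classical
  set J := stoppingCubes φ t with hJ
  have hJd : J.PairwiseDisjoint dyadicCube := pairwiseDisjoint_stoppingCubes φ t
  have hsum : ∑' q : J, ∫⁻ x in dyadicCube (q : ℤ × (Fin n → ℤ)), φ x ^ 2 ≠ ∞ := by
    rw [tsum_setLIntegral_dyadicCube hJd]
    exact ne_top_of_le_ne_top h2 (setLIntegral_le_lintegral _ _)
  -- Tails of a convergent series vanish: the stopping cubes left out contribute less than t ∫ φ,
  -- which is positive.
  have htail := ENNReal.tendsto_tsum_compl_atTop_zero hsum
  obtain ⟨s, hs⟩ := (htail.eventually_lt_const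
    (pos_iff_ne_zero.2 (mul_ne_zero ht h0))).exists
  refine ⟨s.map (Function.Embedding.subtype _), fun q hq => ?_, ?_⟩
  · obtain ⟨p, _, rfl⟩ := Finset.mem_map.1 (Finset.mem_coe.1 hq)
    exact p.2
  set U : Set (EuclideanSpace ℝ (Fin n)) := ⋃ q ∈ J, dyadicCube q with hU
  have hUm : MeasurableSet U :=
    MeasurableSet.biUnion (Set.to_countable J) fun q _ => measurableSet_dyadicCube q
  have hsub : (⋃ q ∈ s.map (Function.Embedding.subtype _), dyadicCube q)ᶜ ⊆
      Uᶜ ∪ ⋃ q : {q : J // q ∉ s}, dyadicCube ((q : J) : ℤ × (Fin n → ℤ)) := by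
    intro x hx
    by_cases hxU : x ∈ U
    · right
      obtain ⟨q, hq, hxq⟩ := Set.mem_iUnion₂.1 hxU
      refine Set.mem_iUnion.2 ⟨⟨⟨q, hq⟩, fun hqs => hx ?_⟩, hxq⟩
      exact Set.mem_iUnion₂.2 ⟨q, Finset.mem_map.2 ⟨⟨q, hq⟩, hqs, rfl⟩, hxq⟩
    · exact Or.inl hxU
  have hgood : ∫⁻ x in Uᶜ, φ x ^ 2 ≤ t * ∫⁻ x, φ x := by
    calc ∫⁻ x in Uᶜ, φ x ^ 2 ≤ ∫⁻ x in Uᶜ, t * φ x := by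
          refine setLIntegral_mono_ae' hUm.compl ?_
          filter_upwards [ae_le_of_notMem_stoppingCubes hn ht hφm h1] with x hx hxU
          rw [sq]
          gcongr
          exact hx fun q hq hxq => hxU (Set.mem_iUnion₂.2 ⟨q, hq, hxq⟩)
      _ ≤ ∫⁻ x, t * φ x := setLIntegral_le_lintegral _ _
      _ = t * ∫⁻ x, φ x := lintegral_const_mul'' _ hφm
  calc _ ≤ ∫⁻ x in Uᶜ ∪ ⋃ q : {q : J // q ∉ s}, dyadicCube ((q : J) : ℤ × (Fin n → ℤ)),
          φ x ^ 2 := lintegral_mono_set hsub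
    _ ≤ (∫⁻ x in Uᶜ, φ x ^ 2) + ∫⁻ x in ⋃ q : {q : J // q ∉ s},
          dyadicCube ((q : J) : ℤ × (Fin n → ℤ)), φ x ^ 2 := lintegral_union_le _ _ _
    _ ≤ (t * ∫⁻ x, φ x) + t * ∫⁻ x, φ x := by
        gcongr
        exact (lintegral_iUnion_le _ _).trans hs.le
    _ = 2 * t * ∫⁻ x, φ x := by ring

lemma lintegral_enorm_sq_Lp {α : Type*} [MeasurableSpace α] {μ : Measure α} (f : Lp 𝕜 2 μ) :
    ∫⁻ x, ‖f x‖ₑ ^ 2 ∂μ = ‖f‖ₑ ^ 2 := by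
  rw [Lp.enorm_def, eLpNorm_eq_lintegral_rpow_enorm_toReal (by norm_num) (by norm_num),
    ← ENNReal.rpow_natCast, ← ENNReal.rpow_mul]
  simp

variable {T : Lp 𝕜 2 (volume : Measure (EuclideanSpace ℝ (Fin n))) →L[𝕜]
    Lp 𝕜 2 (volume : Measure (EuclideanSpace ℝ (Fin n)))}
  {K : EuclideanSpace ℝ (Fin n) → EuclideanSpace ℝ (Fin n) → 𝕜} {CK : ℝ} {ω : ℝ → ℝ}

lemma mul_volume_lt_enorm_le (u : Lp 𝕜 2 (volume : Measure (EuclideanSpace ℝ (Fin n))))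
    (s : ℝ≥0∞) :
    s ^ 2 * volume {x | s < ‖T u x‖ₑ} ≤ ‖T‖ₑ ^ 2 * ∫⁻ x, ‖u x‖ₑ ^ 2 := by
  have hm : AEMeasurable (fun x => ‖T u x‖ₑ ^ 2) :=
    (Lp.aestronglyMeasurable (T u)).enorm.pow_const 2
  calc s ^ 2 * volume {x | s < ‖T u x‖ₑ} ≤ s ^ 2 * volume {x | s ^ 2 ≤ ‖T u x‖ₑ ^ 2} := by
        gcongr
        intro h
        gcongr
    _ ≤ ∫⁻ x, ‖T u x‖ₑ ^ 2 := mul_meas_ge_le_lintegral₀ hm _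
    _ = ‖T u‖ₑ ^ 2 := lintegral_enorm_sq_Lp _
    _ ≤ (‖T‖ₑ * ‖u‖ₑ) ^ 2 := by
        gcongr
        exact T.le_opENorm u
    _ = _ := by rw [mul_pow, lintegral_enorm_sq_Lp]

/-- The image of an atom supported in a dyadic cube, off the dilated cube. -/
lemma IsCalderonZygmund.lintegral_compl_dilate_atom_le (hT : IsCalderonZygmund T K CK ω)
    (hn : 0 < n) (hD : DiniCondition ω) {q : ℤ × (Fin n → ℤ)}
    {b : EuclideanSpace ℝ (Fin n) → 𝕜} (hb : MemLp b 2 volume) (hbi : Integrable b)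
    (hsupp : ∀ x, x ∉ dyadicCube q → b x = 0) (hint : ∫ x, b x = 0) :
    ∫⁻ x in (dilate (4 * n) q)ᶜ, ‖T (hb.toLp b) x‖ₑ ≤
      2 * (2 * (8 * n + 1)) ^ n * ENNReal.ofReal (diniNorm ω) * ∫⁻ y, ‖b y‖ₑ := by
  set c := dyadicCenter q
  have hc : c ∈ dyadicCube q := dyadicCenter_mem q
  -- This supremum need not be measurable; all later steps with its upper integral avoid
  -- measurability.
  let Φ : EuclideanSpace ℝ (Fin n) → ℝ≥0∞ := fun x => ⨆ y ∈ dyadicCube q, ‖K x y - K x c‖ₑ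
  have hpt : ∀ᵐ x, x ∈ (dilate (4 * n) q)ᶜ →
      ‖T (hb.toLp b) x‖ₑ ≤ (∫⁻ y, ‖b y‖ₑ) * (Φ x * 1) := by
    filter_upwards [hT.representation b hb] with x hx hxq
    have hxs : x ∉ tsupport b := by
      intro h
      refine notMem_closure_dyadicCube (by omega) hxq (closure_mono ?_ h)
      intro y hy
      by_contra hyq
      exact hy (hsupp y hyq)
    rw [hx hxs]
    -- The cancellation of b needs integrability; without it the Bochner integral is 0 by default
    -- and the bound is trivial.
    by_cases hi : Integrable fun y => K x y * b y
    · have e : ∫ y, K x y * b y = ∫ y, (K x y - K x c) * b y := by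
        simp_rw [sub_mul]
        rw [integral_sub hi (hbi.const_mul _), integral_const_mul, hint, mul_zero, sub_zero]
      rw [e]
      calc ‖∫ y, (K x y - K x c) * b y‖ₑ ≤ ∫⁻ y, ‖(K x y - K x c) * b y‖ₑ :=
            enorm_integral_le_lintegral_enorm _
        _ ≤ ∫⁻ y, Φ x * ‖b y‖ₑ := by
            refine lintegral_mono fun y => ?_
            rw [enorm_mul]
            by_cases hy : y ∈ dyadicCube q
            · gcongr
              exact le_iSup₂ (f := fun y (_ : y ∈ dyadicCube q) => ‖K x y - K x c‖ₑ) y hy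
            · simp [hsupp y hy]
        _ = _ := by
            rw [lintegral_const_mul'' _ hb.1.enorm, mul_one, mul_comm]
    · rw [integral_undef hi]
      simp
  have hbt : ∫⁻ y, ‖b y‖ₑ ≠ ∞ := hbi.2.ne
  calc ∫⁻ x in (dilate (4 * n) q)ᶜ, ‖T (hb.toLp b) x‖ₑ
      ≤ ∫⁻ x in (dilate (4 * n) q)ᶜ, (∫⁻ y, ‖b y‖ₑ) * (Φ x * 1) :=
        setLIntegral_mono_ae' (measurableSet_dilate _ _).compl hpt
    _ = (∫⁻ y, ‖b y‖ₑ) * ∫⁻ x in (dilate (4 * n) q)ᶜ, Φ x * 1 := lintegral_const_mul' _ _ hbt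
    _ ≤ (∫⁻ y, ‖b y‖ₑ) *
          (2 * (2 * (2 * (4 * n : ℕ) + 1)) ^ n * ENNReal.ofReal (diniNorm ω) * 1) := by
        gcongr
        refine lintegral_compl_dilate_mul_le hT.modulus hD (by omega) (fun j => by simp) ?_
        intro j x hx
        refine iSup₂_le fun y hy => ?_
        exact le_trans le_add_self (hT.enorm_kernel_sub_le hn hy hc j hx)
    _ = _ := by
        push_cast
        ring

/-- The constant in the weak type `(1, 1)` inequality. -/
def weakConst (n : ℕ) : ℕ := 4 * (2 + 2 ^ n) + (8 * n + 1) ^ n + 8 * (2 * (8 * n + 1)) ^ n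

/-- A Calderón–Zygmund operator has weak type `(1, 1)`. -/
theorem IsCalderonZygmund.weak_type (hT : IsCalderonZygmund T K CK ω) (hn : 0 < n)
    (hD : DiniCondition ω) {B : ℝ≥0∞} (hB0 : B ≠ 0) (hBt : B ≠ ∞) (hTB : ‖T‖ₑ ≤ B)
    (hDB : ENNReal.ofReal (diniNorm ω) ≤ B)
    (u : Lp 𝕜 2 (volume : Measure (EuclideanSpace ℝ (Fin n)))) (hu : Integrable u) (s : ℝ≥0∞) :
    s * volume {x | s < ‖T u x‖ₑ} ≤ weakConst n * B * ∫⁻ x, ‖u x‖ₑ := by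
  classical
  rcases eq_or_ne s 0 with rfl | hs0
  · simp
  rcases eq_or_ne s ∞ with rfl | hst
  · simp
  set A := ∫⁻ x, ‖u x‖ₑ with hA
  rcases eq_or_ne A 0 with hA0 | hA0
  · have : u = 0 := by
      rw [Lp.eq_zero_iff_ae_eq_zero]
      have := (lintegral_eq_zero_iff' hu.1.enorm).1 hA0
      filter_upwards [this] with x hx
      simpa using hx
    have h0 : ∀ᵐ x, ¬ s < ‖T u x‖ₑ := by
      rw [this, map_zero]
      simp
    have : volume {x | s < ‖T u x‖ₑ} = 0 := by
      rw [ae_iff] at h0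
      simpa using h0
    simp [this]
  have hAt : A ≠ ∞ := hu.2.ne
  have hu2 : ∫⁻ x, ‖u x‖ₑ ^ 2 ≠ ∞ := by
    rw [lintegral_enorm_sq_Lp]
    finiteness
  -- At this height the L² bound of the good part, of order B² t / s², balances the L¹ bounds, of
  -- order B / s.
  set t := s / B with ht
  have ht0 : t ≠ 0 := (ENNReal.div_pos hs0 hBt).ne'
  have htB : B * t = s := ENNReal.mul_div_cancel hB0 hBt
  obtain ⟨F, hF, hFint⟩ := exists_finset_stoppingCubes hn hu.1.enorm hAt hu2 hA0 ht0
  have hFd : (F : Set (ℤ × (Fin n → ℤ))).PairwiseDisjoint dyadicCube :=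
    (pairwiseDisjoint_stoppingCubes _ t).subset hF
  have hsumF : ∀ φ : EuclideanSpace ℝ (Fin n) → ℝ≥0∞,
      ∑ q ∈ F, ∫⁻ x in dyadicCube q, φ x = ∫⁻ x in ⋃ q ∈ F, dyadicCube q, φ x := fun φ =>
    (lintegral_biUnion_finset hFd (fun q _ => measurableSet_dyadicCube q) φ).symm
  -- averages and atoms
  let av : ℤ × (Fin n → ℤ) → 𝕜 := fun q => ⨍ y in dyadicCube q, u y
  let b : ℤ × (Fin n → ℤ) → EuclideanSpace ℝ (Fin n) → 𝕜 := fun q =>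
    (dyadicCube q).indicator fun x => u x - av q
  have hav : ∀ q, ‖av q‖ₑ * volume (dyadicCube q) ≤ ∫⁻ y in dyadicCube q, ‖u y‖ₑ := by
    intro q
    have h := enorm_integral_le_lintegral_enorm (μ := volume.restrict (dyadicCube q)) (u : _ → 𝕜)
    refine le_trans (le_of_eq ?_) h
    simp only [av]
    rw [setAverage_eq, enorm_smul, measureReal_def, enorm_inv, mul_comm, ← mul_assoc]
    · rw [Real.enorm_of_nonneg ENNReal.toReal_nonneg,
        ENNReal.ofReal_toReal (volume_dyadicCube_ne_top q),
        ENNReal.mul_inv_cancel (volume_dyadicCube_ne_zero q) (volume_dyadicCube_ne_top q), one_mul]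
    · exact (ENNReal.toReal_pos (volume_dyadicCube_ne_zero q) (volume_dyadicCube_ne_top q)).ne'
  have hbint : ∀ q, Integrable (b q) := by
    intro q
    rw [integrable_indicator_iff (measurableSet_dyadicCube q)]
    exact hu.integrableOn.sub (integrableOn_const (volume_dyadicCube_ne_top q))
  have hbmem : ∀ q, MemLp (b q) 2 volume := by
    intro q
    have e : b q = (dyadicCube q).indicator u - (dyadicCube q).indicator fun _ => av q := by
      funext x
      simp only [b, Pi.sub_apply]
      by_cases hx : x ∈ dyadicCube q <;> simp [hx]
    rw [e]
    exact ((Lp.memLp u).indicator (measurableSet_dyadicCube q)).sub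
      (memLp_indicator_const 2 (measurableSet_dyadicCube q) _
        (Or.inr (volume_dyadicCube_ne_top q)))
  have hb0 : ∀ q, ∫ x, b q x = 0 := by
    intro q
    simp only [b]
    rw [integral_indicator (measurableSet_dyadicCube q)]
    have : IsFiniteMeasure (volume.restrict (dyadicCube q)) :=
      ⟨by simpa using (volume_dyadicCube_ne_top q).lt_top⟩
    exact integral_sub_average _ _
  have hb1 : ∀ q, ∫⁻ y, ‖b q y‖ₑ ≤ 2 * ∫⁻ y in dyadicCube q, ‖u y‖ₑ := by
    intro q
    have e : ∀ y, ‖b q y‖ₑ = (dyadicCube q).indicator (fun y => ‖u y - av q‖ₑ) y := by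
      intro y
      simp only [b]
      by_cases hy : y ∈ dyadicCube q <;> simp [hy]
    simp_rw [e]
    rw [lintegral_indicator (measurableSet_dyadicCube q)]
    calc ∫⁻ y in dyadicCube q, ‖u y - av q‖ₑ ≤ ∫⁻ y in dyadicCube q, (‖u y‖ₑ + ‖av q‖ₑ) :=
          lintegral_mono fun y => enorm_sub_le
      _ = (∫⁻ y in dyadicCube q, ‖u y‖ₑ) + ‖av q‖ₑ * volume (dyadicCube q) := by
          rw [lintegral_add_right _ measurable_const, setLIntegral_const]
      _ ≤ _ := by
          rw [two_mul]
          gcongr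
          exact hav q
  let bL : ℤ × (Fin n → ℤ) → Lp 𝕜 2 (volume : Measure (EuclideanSpace ℝ (Fin n))) :=
    fun q => (hbmem q).toLp (b q)
  -- Only finitely many atoms are removed, so linearity of T on L² suffices; the price is the term 2
  -- in 2 + 2 ^ n below.
  set G := u - ∑ q ∈ F, bL q with hG
  have hGae : ∀ᵐ x, G x = u x - ∑ q ∈ F, b q x := by
    have h1 := Lp.coeFn_sub u (∑ q ∈ F, bL q)
    have h2 : ∀ᵐ x, ∀ q ∈ F, bL q x = b q x := by
      refine (Filter.eventually_all_finset F).2 fun q _ => ?_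
      exact (hbmem q).coeFn_toLp
    filter_upwards [h1, Lp.coeFn_finsetSum F bL, h2] with x hx1 hx2 hx3
    rw [hx1, Pi.sub_apply, hx2]
    congr 1
    rw [Finset.sum_apply]
    exact Finset.sum_congr rfl hx3
  have hGin : ∀ᵐ x, ∀ q ∈ F, x ∈ dyadicCube q → G x = av q := by
    filter_upwards [hGae] with x hx q hq hxq
    rw [hx, Finset.sum_eq_single_of_mem q hq]
    · simp [b, hxq]
    · intro p hp hpq
      have : x ∉ dyadicCube p := fun hxp =>
        Set.disjoint_left.1 (hFd (Finset.mem_coe.2 hp) (Finset.mem_coe.2 hq) hpq) hxp hxq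
      simp [b, this]
  have hGout : ∀ᵐ x, x ∈ (⋃ q ∈ F, dyadicCube q)ᶜ → G x = u x := by
    filter_upwards [hGae] with x hx hxF
    rw [hx, Finset.sum_eq_zero, sub_zero]
    intro q hq
    have : x ∉ dyadicCube q := fun h => hxF (Set.mem_iUnion₂.2 ⟨q, hq, h⟩)
    simp [b, this]
  have hFm : MeasurableSet (⋃ q ∈ F, dyadicCube q) :=
    Finset.measurableSet_biUnion F fun q _ => measurableSet_dyadicCube q
  have hG2 : ∫⁻ x, ‖G x‖ₑ ^ 2 ≤ (2 + 2 ^ n) * t * A := by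
    rw [← lintegral_add_compl _ hFm, ← hsumF]
    have hin : ∀ q ∈ F, ∫⁻ x in dyadicCube q, ‖G x‖ₑ ^ 2 ≤
        2 ^ n * t * ∫⁻ x in dyadicCube q, ‖u x‖ₑ := by
      intro q hq
      have e : ∫⁻ x in dyadicCube q, ‖G x‖ₑ ^ 2 = ∫⁻ _x in dyadicCube q, ‖av q‖ₑ ^ 2 := by
        refine setLIntegral_congr_fun_ae (measurableSet_dyadicCube q) ?_
        filter_upwards [hGin] with x hx hxq
        rw [hx q hq hxq]
      have h1 : ‖av q‖ₑ ≤ 2 ^ n * t := by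
        have := (hav q).trans (setLIntegral_le_of_mem_stoppingCubes (hF hq))
        exact (ENNReal.mul_le_mul_iff_left (volume_dyadicCube_ne_zero q)
          (volume_dyadicCube_ne_top q)).1 this
      rw [e, setLIntegral_const, sq, mul_assoc]
      gcongr
      exact hav q
    have hout : ∫⁻ x in (⋃ q ∈ F, dyadicCube q)ᶜ, ‖G x‖ₑ ^ 2 =
        ∫⁻ x in (⋃ q ∈ F, dyadicCube q)ᶜ, ‖u x‖ₑ ^ 2 := by
      refine setLIntegral_congr_fun_ae hFm.compl ?_
      filter_upwards [hGout] with x hx hxF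
      rw [hx hxF]
    rw [hout]
    calc _ ≤ (∑ q ∈ F, 2 ^ n * t * ∫⁻ x in dyadicCube q, ‖u x‖ₑ) + 2 * t * A := by
          gcongr with q hq
          exact hin q hq
      _ ≤ 2 ^ n * t * A + 2 * t * A := by
          rw [← Finset.mul_sum, hsumF]
          gcongr
          exact setLIntegral_le_lintegral _ _
      _ = _ := by ring
  -- the three exceptional sets
  set D : Set (EuclideanSpace ℝ (Fin n)) := ⋃ q ∈ F, dilate (4 * n) q with hDdef
  have hDm : MeasurableSet D :=
    Finset.measurableSet_biUnion F fun q _ => measurableSet_dilate _ q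
  set V1 : Set (EuclideanSpace ℝ (Fin n)) := {x | s / 2 < ‖T G x‖ₑ}
  set V3 : Set (EuclideanSpace ℝ (Fin n)) := {x | s / 2 ≤ ∑ q ∈ F, ‖T (bL q) x‖ₑ}
  have hTu : ∀ᵐ x, T u x = T G x + ∑ q ∈ F, T (bL q) x := by
    have e : T u = T G + ∑ q ∈ F, T (bL q) := by
      rw [hG, map_sub, map_sum, sub_add_cancel]
    rw [e]
    filter_upwards [Lp.coeFn_add (T G) (∑ q ∈ F, T (bL q)),
      Lp.coeFn_finsetSum F fun q => T (bL q)] with x h1 h2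
    rw [h1, Pi.add_apply, h2, Finset.sum_apply]
  have hcover : volume {x | s < ‖T u x‖ₑ} ≤ volume (V1 ∪ (D ∪ (V3 ∩ Dᶜ))) := by
    refine measure_mono_ae ?_
    filter_upwards [hTu] with x hx hxs
    change s < ‖T u x‖ₑ at hxs
    change x ∈ V1 ∪ (D ∪ (V3 ∩ Dᶜ))
    by_cases h1 : x ∈ V1
    · exact Or.inl h1
    by_cases h2 : x ∈ D
    · exact Or.inr (Or.inl h2)
    refine Or.inr (Or.inr ⟨?_, h2⟩)
    by_contra h3
    simp only [V1, V3, Set.mem_ofPred_eq, not_lt, not_le] at h1 h3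
    refine absurd hxs (not_lt.2 ?_)
    rw [hx]
    calc ‖T G x + ∑ q ∈ F, T (bL q) x‖ₑ ≤ ‖T G x‖ₑ + ∑ q ∈ F, ‖T (bL q) x‖ₑ :=
          (enorm_add_le _ _).trans (add_le_add le_rfl (enorm_sum_le _ _))
      _ ≤ s / 2 + s / 2 := add_le_add h1 h3.le
      _ = s := ENNReal.add_halves s
  have hV1 : s * volume V1 ≤ 4 * (2 + 2 ^ n) * B * A := by
    have h1 : (s / 2) ^ 2 * volume V1 ≤ B ^ 2 * ((2 + 2 ^ n) * t * A) :=
      (mul_volume_lt_enorm_le G (s / 2)).trans (by gcongr)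
    have e1 : s * (s * volume V1) = 4 * ((s / 2) ^ 2 * volume V1) := by
      have : (2 : ℝ≥0∞) * (s / 2) = s := ENNReal.mul_div_cancel (by norm_num) (by norm_num)
      conv_lhs => rw [← this]
      ring
    have e2 : s * (4 * (2 + 2 ^ n) * B * A) = 4 * (B ^ 2 * ((2 + 2 ^ n) * t * A)) := by
      rw [← htB]
      ring
    rw [← ENNReal.mul_le_mul_iff_right hs0 hst, e1, e2]
    gcongr
  have hD2 : s * volume D ≤ (8 * n + 1) ^ n * B * A := by
    have h1 : volume D ≤ (8 * n + 1) ^ n * ∑ q ∈ F, volume (dyadicCube q) := by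
      refine (measure_biUnion_finset_le F _).trans ?_
      rw [Finset.mul_sum]
      refine Finset.sum_le_sum fun q _ => ?_
      rw [volume_dilate]
      refine le_of_eq ?_
      push_cast
      ring
    have h2 : t * ∑ q ∈ F, volume (dyadicCube q) ≤ A := by
      rw [Finset.mul_sum]
      calc ∑ q ∈ F, t * volume (dyadicCube q) ≤ ∑ q ∈ F, ∫⁻ x in dyadicCube q, ‖u x‖ₑ :=
            Finset.sum_le_sum fun q hq => (hF hq).1.le
        _ ≤ A := by
            rw [hsumF]
            exact setLIntegral_le_lintegral _ _
    calc s * volume D ≤ (B * t) * ((8 * n + 1) ^ n * ∑ q ∈ F, volume (dyadicCube q)) := by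
          rw [htB]
          gcongr
      _ = (8 * n + 1) ^ n * B * (t * ∑ q ∈ F, volume (dyadicCube q)) := by ring
      _ ≤ _ := by gcongr
  -- The factor 8 is 2 for the level s / 2, times 2 from the atom estimate, times 2 from ‖b q‖₁ ≤ 2
  -- ∫_q |u|.
  have hV3 : s * volume (V3 ∩ Dᶜ) ≤ 8 * (2 * (8 * n + 1)) ^ n * B * A := by
    have hm : AEMeasurable (fun x => ∑ q ∈ F, ‖T (bL q) x‖ₑ) (volume.restrict Dᶜ) :=
      Finset.aemeasurable_fun_sum F fun q _ =>
        (Lp.aestronglyMeasurable (T (bL q))).enorm.restrict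
    have h1 : s / 2 * volume (V3 ∩ Dᶜ) ≤ ∫⁻ x in Dᶜ, ∑ q ∈ F, ‖T (bL q) x‖ₑ := by
      have := mul_meas_ge_le_lintegral₀ hm (s / 2)
      rwa [Measure.restrict_apply' hDm.compl] at this
    have h2 : ∀ q ∈ F, ∫⁻ x in Dᶜ, ‖T (bL q) x‖ₑ ≤
        2 * (2 * (8 * n + 1)) ^ n * B * (2 * ∫⁻ y in dyadicCube q, ‖u y‖ₑ) := by
      intro q hq
      calc ∫⁻ x in Dᶜ, ‖T (bL q) x‖ₑ ≤ ∫⁻ x in (dilate (4 * n) q)ᶜ, ‖T (bL q) x‖ₑ := by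
            refine lintegral_mono_set (Set.compl_subset_compl.2 ?_)
            exact Set.subset_biUnion_of_mem (u := fun q => dilate (4 * n) q) (Finset.mem_coe.2 hq)
        _ ≤ _ := hT.lintegral_compl_dilate_atom_le hn hD (hbmem q) (hbint q)
            (fun x hx => by simp [b, hx]) (hb0 q)
        _ ≤ _ := by
            gcongr
            exact hb1 q
    calc s * volume (V3 ∩ Dᶜ) = 2 * (s / 2 * volume (V3 ∩ Dᶜ)) := by
          rw [← mul_assoc, ENNReal.mul_div_cancel (by norm_num) (by norm_num)]
      _ ≤ 2 * ∑ q ∈ F, ∫⁻ x in Dᶜ, ‖T (bL q) x‖ₑ := by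
          rw [← lintegral_finsetSum' F fun q _ =>
            (Lp.aestronglyMeasurable (T (bL q))).enorm.restrict]
          gcongr
      _ ≤ 2 * ∑ q ∈ F, 2 * (2 * (8 * n + 1)) ^ n * B * (2 * ∫⁻ y in dyadicCube q, ‖u y‖ₑ) := by
          gcongr with q hq
          exact h2 q hq
      _ = 8 * (2 * (8 * n + 1)) ^ n * B * ∫⁻ x in ⋃ q ∈ F, dyadicCube q, ‖u x‖ₑ := by
          rw [← hsumF, ← Finset.mul_sum, ← Finset.mul_sum]
          ring
      _ ≤ _ := by
          gcongr
          exact setLIntegral_le_lintegral _ _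
  calc s * volume {x | s < ‖T u x‖ₑ} ≤ s * (volume V1 + (volume D + volume (V3 ∩ Dᶜ))) := by
        gcongr
        refine hcover.trans ((measure_union_le _ _).trans ?_)
        gcongr
        exact measure_union_le _ _
    _ = s * volume V1 + (s * volume D + s * volume (V3 ∩ Dᶜ)) := by ring
    _ ≤ 4 * (2 + 2 ^ n) * B * A +
          ((8 * n + 1) ^ n * B * A + 8 * (2 * (8 * n + 1)) ^ n * B * A) := by gcongr
    _ = weakConst n * B * A := by
        simp only [weakConst]
        push_cast
        ring

end WeakType

/-! ### Extension to L¹ and oscillation of the extended operator. -/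

section Extension

variable {n : ℕ} {𝕜 : Type*} [RCLike 𝕜]

/-- A Fatou lemma for weak type bounds. -/
lemma mul_measure_lt_enorm_le_of_tendsto {α : Type*} [MeasurableSpace α] {μ : Measure α}
    {v : ℕ → α → 𝕜} {g : α → 𝕜} (hv : ∀ᵐ x ∂μ, Tendsto (fun k => v k x) atTop (𝓝 (g x)))
    {s c : ℝ≥0∞} {d : ℕ → ℝ≥0∞} (hd : ∀ k, s * μ {x | s < ‖v k x‖ₑ} ≤ d k)
    (hdc : Tendsto d atTop (𝓝 c)) : s * μ {x | s < ‖g x‖ₑ} ≤ c := by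
  let A : ℕ → Set α := fun N => {x | ∀ k, N ≤ k → s < ‖v k x‖ₑ}
  have hA : Monotone A := fun i j hij x hx k hk => hx k (hij.trans hk)
  -- The strict inequality is an open condition, so it holds for all large k; the sets A N increase,
  -- and continuity from below needs no measurability.
  have hsub : μ {x | s < ‖g x‖ₑ} ≤ μ (⋃ N, A N) := by
    refine measure_mono_ae ?_
    filter_upwards [hv] with x hx hxs
    change s < ‖g x‖ₑ at hxs
    change x ∈ ⋃ N, A N
    obtain ⟨N, hN⟩ := eventually_atTop.1 (hx.enorm.eventually_const_lt hxs)
    exact Set.mem_iUnion.2 ⟨N, hN⟩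
  refine (mul_le_mul_right hsub s).trans ?_
  rw [hA.measure_iUnion, ENNReal.mul_iSup]
  refine iSup_le fun N => ge_of_tendsto hdc ?_
  filter_upwards [eventually_ge_atTop N] with k hk
  exact (mul_le_mul_right (measure_mono fun x (hx : x ∈ A N) => hx k hk) s).trans (hd k)

/-- Truncations of an integrable function. -/
lemma exists_seq_Lp_two_of_integrable {f : EuclideanSpace ℝ (Fin n) → 𝕜} (hf : Integrable f) :
    ∃ u : ℕ → Lp 𝕜 2 (volume : Measure (EuclideanSpace ℝ (Fin n))),
      (∀ k, Integrable (u k)) ∧ (∀ᵐ x, ∀ k, ‖u k x‖ₑ ≤ ‖f x‖ₑ) ∧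
      Tendsto (fun k => ∫⁻ x, ‖u k x - f x‖ₑ) atTop (𝓝 0) := by
  let s : ℕ → Set (EuclideanSpace ℝ (Fin n)) := fun k => {x | ‖f x‖ ≤ k}
  have hs : ∀ k, NullMeasurableSet (s k) := fun k =>
    nullMeasurableSet_le hf.1.norm.aemeasurable aemeasurable_const
  let v : ℕ → EuclideanSpace ℝ (Fin n) → 𝕜 := fun k => (s k).indicator f
  have hvi : ∀ k, Integrable (v k) := fun k => hf.indicator₀ (hs k)
  have hvf : ∀ k x, ‖v k x‖ ≤ ‖f x‖ := fun k x => norm_indicator_le_norm_self _ _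
  have hvk : ∀ k x, ‖v k x‖ ≤ k := by
    intro k x
    by_cases hx : x ∈ s k
    · rw [show v k x = f x from Set.indicator_of_mem hx f]
      exact hx
    · simp [v, hx]
  have hv2 : ∀ k, MemLp (v k) 2 volume := by
    intro k
    rw [memLp_two_iff_integrable_sq_norm (hvi k).1]
    refine (hf.norm.const_mul (k : ℝ)).mono' ((hvi k).1.norm.pow 2) (Eventually.of_forall fun x => ?_)
    rw [Real.norm_of_nonneg (by positivity), sq]
    exact mul_le_mul (hvk k x) (hvf k x) (norm_nonneg _) (by positivity)
  have hae : ∀ᵐ x, ∀ k, (hv2 k).toLp (v k) x = v k x := ae_all_iff.2 fun k => (hv2 k).coeFn_toLp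
  refine ⟨fun k => (hv2 k).toLp (v k), fun k => (integrable_congr (hv2 k).coeFn_toLp).2 (hvi k),
    ?_, ?_⟩
  · filter_upwards [hae] with x hx k
    rw [hx k, enorm_le_iff_norm_le]
    exact hvf k x
  · have e : ∀ k, ∫⁻ x, ‖(hv2 k).toLp (v k) x - f x‖ₑ = ∫⁻ x, ‖v k x - f x‖ₑ := by
      intro k
      refine lintegral_congr_ae ?_
      filter_upwards [hae] with x hx
      rw [hx k]
    simp_rw [e]
    have h0 : ∫⁻ _x : EuclideanSpace ℝ (Fin n), (0 : ℝ≥0∞) = 0 := lintegral_zero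
    rw [← h0]
    refine tendsto_lintegral_of_dominated_convergence' (fun x => ‖f x‖ₑ)
      (fun k => ((hvi k).1.sub hf.1).enorm) (fun k => Eventually.of_forall fun x => ?_)
      hf.2.ne (Eventually.of_forall fun x => ?_)
    · by_cases hx : x ∈ s k <;> simp [v, hx]
    · refine tendsto_const_nhds.congr' ?_
      obtain ⟨N, hN⟩ := exists_nat_ge ‖f x‖
      filter_upwards [eventually_ge_atTop N] with k hk
      have : x ∈ s k := hN.trans (by exact_mod_cast hk)
      simp [v, this]

variable {T : Lp 𝕜 2 (volume : Measure (EuclideanSpace ℝ (Fin n))) →L[𝕜]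
    Lp 𝕜 2 (volume : Measure (EuclideanSpace ℝ (Fin n)))}

/-- The operator `T` has weak type `(1, 1)` with constant `C` on `L¹ ∩ L²`. -/
def HasWeakType (T : Lp 𝕜 2 (volume : Measure (EuclideanSpace ℝ (Fin n))) →L[𝕜]
    Lp 𝕜 2 (volume : Measure (EuclideanSpace ℝ (Fin n)))) (C : ℝ≥0∞) : Prop :=
  ∀ u : Lp 𝕜 2 (volume : Measure (EuclideanSpace ℝ (Fin n))), Integrable u → ∀ s : ℝ≥0∞,
    s * volume {x | s < ‖T u x‖ₑ} ≤ C * ∫⁻ x, ‖u x‖ₑ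

lemma HasWeakType.sub {C : ℝ≥0∞} (hT : HasWeakType T C)
    {u v : Lp 𝕜 2 (volume : Measure (EuclideanSpace ℝ (Fin n)))} (hu : Integrable u)
    (hv : Integrable v) (s : ℝ≥0∞) :
    s * volume {x | s < ‖T u x - T v x‖ₑ} ≤ C * ∫⁻ x, ‖u x - v x‖ₑ := by
  have h1 : (T (u - v) : EuclideanSpace ℝ (Fin n) → 𝕜) =ᵐ[volume] fun x => T u x - T v x := by
    rw [map_sub]
    exact Lp.coeFn_sub _ _
  have h2 := Lp.coeFn_sub u v
  have h := hT (u - v) ((integrable_congr h2).2 (hu.sub hv)) s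
  have e1 : volume {x | s < ‖T u x - T v x‖ₑ} = volume {x | s < ‖T (u - v) x‖ₑ} := by
    refine measure_congr ?_
    filter_upwards [h1] with x hx
    exact propext (show s < ‖T u x - T v x‖ₑ ↔ s < ‖T (u - v) x‖ₑ by rw [hx])
  have e2 : ∫⁻ x, ‖u x - v x‖ₑ = ∫⁻ x, ‖(u - v : Lp 𝕜 2 volume) x‖ₑ := by
    refine lintegral_congr_ae ?_
    filter_upwards [h2] with x hx
    rw [hx, Pi.sub_apply]
  rwa [e1, e2]

lemma lintegral_enorm_sub_le {f g h : EuclideanSpace ℝ (Fin n) → 𝕜} (hf : AEStronglyMeasurable f)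
    (hg : AEStronglyMeasurable g) :
    ∫⁻ x, ‖f x - h x‖ₑ ≤ (∫⁻ x, ‖f x - g x‖ₑ) + ∫⁻ x, ‖g x - h x‖ₑ := by
  rw [← lintegral_add_left' (f := fun x => ‖f x - g x‖ₑ) (hf.sub hg).enorm]
  refine lintegral_mono fun x => ?_
  rw [← sub_add_sub_cancel (f x) (g x) (h x)]
  exact enorm_add_le _ _

/-- An operator of weak type `(1, 1)` extends to `L¹`. -/
theorem HasWeakType.exists_isL1Extension {C : ℝ≥0∞} (hT : HasWeakType T C) (hC : C ≠ ∞)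
    {f : EuclideanSpace ℝ (Fin n) → 𝕜} (hf : Integrable f) : ∃ g, IsL1Extension T f g := by
  obtain ⟨u, hui, -, hu⟩ := exists_seq_Lp_two_of_integrable hf
  -- L¹ errors 4^{-k} against heights 2^{-k} leave exceptional sets of measure O(2^{-k}), which is
  -- summable for Borel–Cantelli.
  have hε : ∀ k : ℕ, ∃ N, ∫⁻ x, ‖u N x - f x‖ₑ ≤ (1 / 4) ^ k := fun k =>
    (hu.eventually_le_const (by
      refine ENNReal.pow_pos ?_ k
      simp)).exists
  choose N hN using hε
  set w : ℕ → Lp 𝕜 2 (volume : Measure (EuclideanSpace ℝ (Fin n))) := fun k => u (N k) with hw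
  have hwi : ∀ k, Integrable (w k) := fun k => hui _
  have hwf : Tendsto (fun k => ∫⁻ x, ‖w k x - f x‖ₑ) atTop (𝓝 0) := by
    refine tendsto_of_tendsto_of_tendsto_of_le_of_le tendsto_const_nhds
      (ENNReal.tendsto_pow_atTop_nhds_zero_of_lt_one (r := 1 / 4) ?_) (fun _ => zero_le) hN
    rw [ENNReal.div_lt_iff (by simp) (by simp)]
    norm_num
  have hstep : ∀ k, volume {x | (1 / 2) ^ k < ‖T (w (k + 1)) x - T (w k) x‖ₑ} ≤
      2 * C * (1 / 2) ^ k := by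
    intro k
    have h := hT.sub (hwi (k + 1)) (hwi k) ((1 / 2) ^ k)
    have h2 : ∫⁻ x, ‖w (k + 1) x - w k x‖ₑ ≤ 2 * (1 / 4) ^ k := by
      refine (lintegral_enorm_sub_le (hwi _).1 hf.1).trans ?_
      rw [two_mul]
      refine add_le_add ((hN (k + 1)).trans ?_) ?_
      · exact pow_le_pow_right_of_le_one' (by simp) (Nat.le_succ k)
      · simp_rw [enorm_sub_rev (f _)]
        exact hN k
    have h3 : (2 : ℝ≥0∞) ^ k * (1 / 2) ^ k = 1 := by
      rw [← mul_pow, one_div, ENNReal.mul_inv_cancel (by norm_num) (by norm_num), one_pow]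
    have h4 : (2 : ℝ≥0∞) ^ k * (1 / 4) ^ k = (1 / 2) ^ k := by
      have : (1 : ℝ≥0∞) / 4 = (1 / 2) * (1 / 2) := by
        rw [one_div, one_div, ← ENNReal.mul_inv (by simp) (by simp)]
        norm_num
      rw [this, mul_pow, ← mul_assoc, h3, one_mul]
    calc volume {x | (1 / 2) ^ k < ‖T (w (k + 1)) x - T (w k) x‖ₑ}
        = 2 ^ k * ((1 / 2) ^ k * volume {x | (1 / 2) ^ k < ‖T (w (k + 1)) x - T (w k) x‖ₑ}) := by
          rw [← mul_assoc, h3, one_mul]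
      _ ≤ 2 ^ k * (C * (2 * (1 / 4) ^ k)) := by
          refine mul_le_mul_right ?_ _
          exact h.trans (mul_le_mul_right h2 C)
      _ = 2 * C * (2 ^ k * (1 / 4) ^ k) := by ring
      _ = _ := by rw [h4]
  have hBC : ∀ᵐ x, ∀ᶠ k in atTop, ¬ (1 / 2) ^ k < ‖T (w (k + 1)) x - T (w k) x‖ₑ := by
    refine ae_eventually_notMem
      (s := fun k => {x | (1 / 2) ^ k < ‖T (w (k + 1)) x - T (w k) x‖ₑ}) ?_
    refine ne_top_of_le_ne_top ?_ (ENNReal.tsum_le_tsum hstep)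
    rw [ENNReal.tsum_mul_left]
    refine ENNReal.mul_ne_top (ENNReal.mul_ne_top (by simp) hC) ?_
    rw [one_div, ENNReal.tsum_geometric, ENNReal.one_sub_inv_two]
    simp
  have hlim : ∀ᵐ x, ∃ l, Tendsto (fun k => T (w k) x) atTop (𝓝 l) := by
    filter_upwards [hBC] with x hx
    refine cauchySeq_tendsto_of_complete (cauchySeq_of_summable_dist ?_)
    refine Summable.of_norm_bounded_eventually_nat (g := fun k => (1 / 2) ^ k)
      summable_geometric_two ?_
    filter_upwards [hx] with k hk
    rw [dist_comm, dist_eq_norm, norm_norm]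
    rw [not_lt, ← ofReal_norm] at hk
    have e : ((1 : ℝ≥0∞) / 2) ^ k = ENNReal.ofReal ((1 / 2) ^ k) := by
      rw [ENNReal.ofReal_pow (by norm_num), ENNReal.ofReal_div_of_pos (by norm_num)]
      simp
    rw [e] at hk
    exact (ENNReal.ofReal_le_ofReal_iff (by positivity)).1 hk
  obtain ⟨g, hg, hgl⟩ := exists_stronglyMeasurable_limit_of_tendsto_ae
    (fun k => Lp.aestronglyMeasurable (T (w k))) hlim
  refine ⟨g, hg.aestronglyMeasurable, fun v hvi hv => ?_⟩
  -- Letting the second index of T(v k) - T(w i) tend to infinity shows that the limit g does not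
  -- depend on the approximating sequence.
  have hweak : ∀ k s, s * volume {x | s < ‖T (v k) x - g x‖ₑ} ≤
      C * ∫⁻ x, ‖v k x - f x‖ₑ := by
    intro k s
    refine mul_measure_lt_enorm_le_of_tendsto (v := fun i x => T (v k) x - T (w i) x)
      (d := fun i => C * ((∫⁻ x, ‖v k x - f x‖ₑ) + ∫⁻ x, ‖w i x - f x‖ₑ)) ?_ ?_ ?_
    · filter_upwards [hgl] with x hx using hx.const_sub _
    · intro i
      refine (hT.sub (hvi k) (hwi i) s).trans ?_
      gcongr
      refine (lintegral_enorm_sub_le (hvi k).1 hf.1).trans (le_of_eq ?_)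
      simp_rw [enorm_sub_rev (f _)]
    · have := (hwf.const_add (∫⁻ x, ‖v k x - f x‖ₑ))
      rw [add_zero] at this
      exact ENNReal.Tendsto.const_mul this (Or.inr hC)
  simp_rw [eLpNorm_one_eq_lintegral_enorm] at hv
  refine tendstoInMeasure_of_ne_top fun ε hε hεt => ?_
  have hε2 : ε / 2 ≠ 0 := (ENNReal.div_pos hε.ne' (by simp)).ne'
  have hε2t : ε / 2 ≠ ∞ := ENNReal.div_ne_top hεt (by simp)
  have hle : ∀ k, volume {x | ε ≤ edist (T (v k) x) (g x)} ≤
      (ε / 2)⁻¹ * (C * ∫⁻ x, ‖v k x - f x‖ₑ) := by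
    intro k
    rw [← ENNReal.div_eq_inv_mul, ENNReal.le_div_iff_mul_le (Or.inl hε2) (Or.inl hε2t), mul_comm]
    refine le_trans ?_ (hweak k (ε / 2))
    gcongr
    rw [edist_eq_enorm_sub]
    exact fun h => lt_of_lt_of_le (ENNReal.half_lt_self hε.ne' hεt) h
  refine tendsto_of_tendsto_of_tendsto_of_le_of_le tendsto_const_nhds ?_ (fun _ => zero_le) hle
  have := ENNReal.Tendsto.const_mul (a := (ε / 2)⁻¹)
    (ENNReal.Tendsto.const_mul (a := C) hv (Or.inr hC)) (Or.inr (ENNReal.inv_ne_top.2 hε2))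
  simpa using this

/-- Convergence in measure becomes convergence almost everywhere along a subsequence of truncations;
the domination by |f| lets estimates pass to the limit without loss. -/
lemma IsL1Extension.exists_seq {f g : EuclideanSpace ℝ (Fin n) → 𝕜} (hg : IsL1Extension T f g)
    (hf : Integrable f) :
    ∃ u : ℕ → Lp 𝕜 2 (volume : Measure (EuclideanSpace ℝ (Fin n))),
      (∀ k, Integrable (u k)) ∧ (∀ᵐ x, ∀ k, ‖u k x‖ₑ ≤ ‖f x‖ₑ) ∧
      Tendsto (fun k => ∫⁻ x, ‖u k x - f x‖ₑ) atTop (𝓝 0) ∧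
      ∀ᵐ x, Tendsto (fun k => T (u k) x) atTop (𝓝 (g x)) := by
  obtain ⟨u, hui, huf, hu⟩ := exists_seq_Lp_two_of_integrable hf
  have h := hg.2 u hui (by simpa only [eLpNorm_one_eq_lintegral_enorm] using hu)
  obtain ⟨ns, hns, hlim⟩ := h.exists_seq_tendsto_ae
  refine ⟨fun k => u (ns k), fun k => hui _, ?_, hu.comp hns.tendsto_atTop, hlim⟩
  filter_upwards [huf] with x hx k using hx _

lemma IsL1Extension.mul_volume_lt_enorm_le {C : ℝ≥0∞} (hT : HasWeakType T C)
    {f g : EuclideanSpace ℝ (Fin n) → 𝕜} (hg : IsL1Extension T f g) (hf : Integrable f)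
    (s : ℝ≥0∞) : s * volume {x | s < ‖g x‖ₑ} ≤ C * ∫⁻ x, ‖f x‖ₑ := by
  obtain ⟨u, hui, huf, -, hlim⟩ := hg.exists_seq hf
  refine mul_measure_lt_enorm_le_of_tendsto hlim (d := fun _ => C * ∫⁻ x, ‖f x‖ₑ) (fun k => ?_)
    tendsto_const_nhds
  refine (hT (u k) (hui k) s).trans ?_
  refine mul_le_mul_right (lintegral_mono_ae ?_) C
  filter_upwards [huf] with x hx using hx k

/-- This is what allows fχ_{q*} to be split into its parts inside and outside p*. -/
lemma IsL1Extension.add_ae_eq {f₁ f₂ g₁ g₂ g : EuclideanSpace ℝ (Fin n) → 𝕜}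
    (h₁ : IsL1Extension T f₁ g₁) (h₂ : IsL1Extension T f₂ g₂) (h : IsL1Extension T (f₁ + f₂) g)
    (hf₁ : Integrable f₁) (hf₂ : Integrable f₂) : ∀ᵐ x, g x = g₁ x + g₂ x := by
  obtain ⟨u, hui, -, hu, hulim⟩ := h₁.exists_seq hf₁
  obtain ⟨v, hvi, -, hv, hvlim⟩ := h₂.exists_seq hf₂
  have hadd : ∀ k, ((u k + v k : Lp 𝕜 2 volume) : EuclideanSpace ℝ (Fin n) → 𝕜) =ᵐ[volume]
      fun x => u k x + v k x := fun k => Lp.coeFn_add _ _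
  have hT := h.2 (fun k => u k + v k)
    (fun k => (integrable_congr (hadd k)).2 ((hui k).add (hvi k))) (by
      simp_rw [eLpNorm_one_eq_lintegral_enorm]
      have h0 := hu.add hv
      rw [add_zero] at h0
      refine tendsto_of_tendsto_of_tendsto_of_le_of_le tendsto_const_nhds h0
        (fun _ => zero_le) fun k => ?_
      rw [← lintegral_add_left' (f := fun x => ‖u k x - f₁ x‖ₑ) ((hui k).1.sub hf₁.1).enorm]
      refine lintegral_mono_ae ?_
      filter_upwards [hadd k] with x hx
      rw [hx, Pi.add_apply, add_sub_add_comm]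
      exact enorm_add_le _ _)
  obtain ⟨ns, hns, hlim⟩ := hT.exists_seq_tendsto_ae
  have hTadd : ∀ᵐ x, ∀ k, T (u k + v k) x = T (u k) x + T (v k) x := by
    refine ae_all_iff.2 fun k => ?_
    rw [map_add]
    exact Lp.coeFn_add _ _
  filter_upwards [hulim, hvlim, hlim, hTadd] with x h1 h2 h3 h4
  refine tendsto_nhds_unique h3 ?_
  simp_rw [h4]
  exact (h1.add h2).comp hns.tendsto_atTop

lemma IsL1Extension.ae_eq {f g g' : EuclideanSpace ℝ (Fin n) → 𝕜} (hg : IsL1Extension T f g)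
    (hg' : IsL1Extension T f g') (hf : Integrable f) : g =ᵐ[volume] g' := by
  obtain ⟨u, hui, -, hu, -⟩ := hg.exists_seq hf
  have h : Tendsto (fun k => eLpNorm (fun x => u k x - f x) 1 volume) atTop (𝓝 0) := by
    simpa only [eLpNorm_one_eq_lintegral_enorm] using hu
  exact tendstoInMeasure_ae_unique (hg.2 u hui h) (hg'.2 u hui h)

/-- The Dini sum converges, so ω tends to 0 along powers of 1/2, and monotonicity fills the gaps. -/
lemma tendsto_modulus {ω : ℝ → ℝ} (hω : IsModulusOfContinuity ω) (hD : DiniCondition ω) :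
    Tendsto ω (𝓝[≥] 0) (𝓝 0) := by
  have h1 : Tendsto (fun j : ℕ => ENNReal.ofReal (ω ((1 / 2) ^ (j + 1)))) atTop (𝓝 0) :=
    ENNReal.tendsto_atTop_zero_of_tsum_ne_top
      (ne_top_of_le_ne_top (by finiteness) (tsum_ofReal_modulus_le hω hD))
  rw [Metric.tendsto_nhds]
  intro ε hε
  obtain ⟨j, hj⟩ := (h1.eventually_lt_const (ENNReal.ofReal_pos.2 hε)).exists
  rw [ENNReal.ofReal_lt_ofReal_iff hε] at hj
  have hlt : (0 : ℝ) < (1 / 2) ^ (j + 1) := by positivity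
  filter_upwards [Ico_mem_nhdsGE hlt] with t ht
  have hle1 : ((1 : ℝ) / 2) ^ (j + 1) ≤ 1 := pow_le_one₀ (by norm_num) (by norm_num)
  rw [Real.dist_eq, sub_zero, abs_of_nonneg (hω.nonneg ht.1 (ht.2.le.trans hle1))]
  exact (hω.mono ⟨ht.1, ht.2.le.trans hle1⟩ ⟨hlt.le, hle1⟩ ht.2.le).trans_lt hj

variable {K : EuclideanSpace ℝ (Fin n) → EuclideanSpace ℝ (Fin n) → 𝕜} {CK : ℝ} {ω : ℝ → ℝ}

/-- Measurability of the kernel is not assumed; continuity off the diagonal supplies it. -/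
lemma IsCalderonZygmund.continuousOn_kernel (hT : IsCalderonZygmund T K CK ω)
    (hD : DiniCondition ω) (x : EuclideanSpace ℝ (Fin n)) : ContinuousOn (K x) {x}ᶜ := by
  intro y hy
  refine ContinuousAt.continuousWithinAt ?_
  have hyx : 0 < ‖y - x‖ := norm_pos_iff.2 (sub_ne_zero.2 hy)
  rw [ContinuousAt, tendsto_iff_norm_sub_tendsto_zero]
  have h1 : Tendsto (fun y' => ‖y - y'‖ / ‖y - x‖) (𝓝 y) (𝓝[≥] 0) := by
    refine tendsto_nhdsWithin_iff.2 ⟨?_, Eventually.of_forall fun y' => by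
      simp only [Set.mem_Ici]; positivity⟩
    have : Continuous fun y' => ‖y - y'‖ / ‖y - x‖ := by fun_prop
    simpa using this.tendsto y
  have h2 : Tendsto (fun y' => ω (‖y - y'‖ / ‖y - x‖) * (1 / ‖y - x‖ ^ n)) (𝓝 y) (𝓝 0) := by
    simpa using ((tendsto_modulus hT.modulus hD).comp h1).mul_const (1 / ‖y - x‖ ^ n)
  refine tendsto_of_tendsto_of_tendsto_of_le_of_le' tendsto_const_nhds h2
    (Eventually.of_forall fun _ => norm_nonneg _) ?_
  have h3 : ∀ᶠ y' in 𝓝 y, 2 * ‖y - y'‖ < ‖y - x‖ := by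
    have : Continuous fun y' => 2 * ‖y - y'‖ := by fun_prop
    exact this.continuousAt.eventually_lt continuousAt_const (by simpa using hyx)
  filter_upwards [h3] with y' hy'
  have := hT.smoothness y y' x hy'
  rw [norm_sub_rev]
  linarith [norm_nonneg (K y x - K y' x)]

/-- The size bound makes K(x, ·) bounded off the dilate. It is needed only qualitatively, to
subtract two kernel integrals. -/
lemma IsCalderonZygmund.integrable_kernel_mul (hT : IsCalderonZygmund T K CK ω)
    (hD : DiniCondition ω) (hn : 0 < n) {q : ℤ × (Fin n → ℤ)}
    {x : EuclideanSpace ℝ (Fin n)} (hx : x ∈ dyadicCube q) {f : EuclideanSpace ℝ (Fin n) → 𝕜}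
    (hf : Integrable f) (hfq : ∀ y ∈ dilate (4 * n) q, f y = 0) :
    Integrable fun y => K x y * f y := by
  have hm : MeasurableSet (dilate (4 * n) q)ᶜ := (measurableSet_dilate _ q).compl
  have hsupp : Function.support (fun y => K x y * f y) ⊆ (dilate (4 * n) q)ᶜ := by
    intro y hy hyq
    exact hy (by simp [hfq y hyq])
  rw [← integrableOn_iff_integrable_of_support_subset hsupp]
  have hr : (0 : ℝ) < (4 * n : ℕ) * 2 ^ q.1 := by positivity
  refine Integrable.bdd_mul (c := CK / ((4 * n : ℕ) * 2 ^ q.1) ^ n) hf.integrableOn ?_ ?_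
  · refine (ContinuousOn.mono (hT.continuousOn_kernel hD x) ?_).aestronglyMeasurable hm
    intro y hy hyx
    rw [Set.mem_singleton_iff] at hyx
    exact hy (hyx ▸ dyadicCube_subset_dilate _ _ hx)
  · filter_upwards [ae_restrict_mem hm] with y hy
    have h1 := le_norm_sub_of_notMem_dilate hx hy
    have hpos := hr.trans_le h1
    have h2 := hT.size x y (sub_ne_zero.1 (norm_pos_iff.1 hpos))
    have hCK : 0 ≤ CK := by
      have := (norm_nonneg _).trans h2
      by_contra h
      have := div_neg_of_neg_of_pos (not_le.1 h) (pow_pos hpos n)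
      linarith
    refine h2.trans ?_
    gcongr

/-- The oscillation on a dyadic cube of `T f`, where `f` vanishes on the dilated cube. -/
theorem IsCalderonZygmund.ae_enorm_extension_le (hT : IsCalderonZygmund T K CK ω)
    (hD : DiniCondition ω) (hn : 0 < n) {q : ℤ × (Fin n → ℤ)}
    {f g : EuclideanSpace ℝ (Fin n) → 𝕜} (hf : Integrable f) (hg : IsL1Extension T f g)
    (hfq : ∀ y ∈ dilate (4 * n) q, f y = 0) {a : ℝ≥0∞}
    (ha : ∀ j, ∫⁻ y in dilate (4 * n) (ancestor j q), ‖f y‖ₑ ≤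
      a * volume (dilate (4 * n) (ancestor j q))) :
    ∃ N : Set (EuclideanSpace ℝ (Fin n)), volume N = 0 ∧ ∀ x ∈ dyadicCube q \ N,
      ∀ z ∈ dyadicCube q \ N,
        ‖g x‖ₑ ≤ ‖g z‖ₑ + 2 * (2 * (8 * n + 1)) ^ n * ENNReal.ofReal (diniNorm ω) * a := by
  obtain ⟨u, hui, huf, -, hlim⟩ := hg.exists_seq hf
  set R := (dilate (4 * n) q)ᶜ with hR
  have hRm : MeasurableSet R := (measurableSet_dilate _ q).compl
  -- Each u k vanishes only almost everywhere on the dilate, which says nothing about its closed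
  -- support; v k vanishes there everywhere.
  let v : ℕ → EuclideanSpace ℝ (Fin n) → 𝕜 := fun k => R.indicator (u k)
  have huv : ∀ k, u k =ᵐ[volume] v k := by
    intro k
    filter_upwards [huf] with x hx
    by_cases hxR : x ∈ R
    · simp [v, hxR]
    · have h0 : f x = 0 := hfq x (by simpa [hR] using hxR)
      have := hx k
      rw [h0, enorm_zero, nonpos_iff_eq_zero, enorm_eq_zero] at this
      simp [v, hxR, this]
  have hv2 : ∀ k, MemLp (v k) 2 volume := fun k => (Lp.memLp (u k)).indicator hRm
  have hvi : ∀ k, Integrable (v k) := fun k => (hui k).indicator hRm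
  have hvq : ∀ k, ∀ y ∈ dilate (4 * n) q, v k y = 0 := by
    intro k y hy
    have : y ∉ R := fun h => h hy
    simp [v, this]
  have hrep : ∀ᵐ x, ∀ k, x ∈ dyadicCube q → T (u k) x = ∫ y, K x y * v k y := by
    refine ae_all_iff.2 fun k => ?_
    have e : (hv2 k).toLp (v k) = u k := by
      refine Lp.ext ?_
      filter_upwards [(hv2 k).coeFn_toLp, huv k] with x h1 h2
      rw [h1, h2]
    filter_upwards [hT.representation (v k) (hv2 k)] with x hx hxq
    rw [← hx ?_, e]
    intro h
    refine notMem_closure_compl_dilate (m := 4 * n) (by omega) hxq (closure_mono ?_ h)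
    exact Set.support_indicator_subset
  have hvf : ∀ᵐ y, ∀ k, ‖v k y‖ₑ ≤ ‖f y‖ₑ := by
    filter_upwards [huf, ae_all_iff.2 huv] with y h1 h2 k
    rw [← h2 k]
    exact h1 k
  have hgood : ∀ᵐ x, (∀ k, x ∈ dyadicCube q → T (u k) x = ∫ y, K x y * v k y) ∧
      Tendsto (fun k => T (u k) x) atTop (𝓝 (g x)) := hrep.and hlim
  -- One null set serves both points, because z is picked later by a measure argument.
  refine ⟨_, ae_iff.1 hgood, fun x hx z hz => ?_⟩
  obtain ⟨hx, hxN⟩ := hx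
  obtain ⟨hz, hzN⟩ := hz
  simp only [Set.mem_ofPred_eq, not_not] at hxN hzN
  set c := 2 * (2 * (8 * n + 1)) ^ n * ENNReal.ofReal (diniNorm ω) * a
  have hk : ∀ k, ‖T (u k) x‖ₑ ≤ ‖T (u k) z‖ₑ + c := by
    intro k
    have hdiff : ‖T (u k) x - T (u k) z‖ₑ ≤ c := by
      rw [hxN.1 k hx, hzN.1 k hz, ← integral_sub (hT.integrable_kernel_mul hD hn hx (hvi k) (hvq k))
        (hT.integrable_kernel_mul hD hn hz (hvi k) (hvq k))]
      simp_rw [← sub_mul]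
      calc ‖∫ y, (K x y - K z y) * v k y‖ₑ ≤ ∫⁻ y, ‖(K x y - K z y) * v k y‖ₑ :=
            enorm_integral_le_lintegral_enorm _
        _ ≤ ∫⁻ y in R, ‖K x y - K z y‖ₑ * ‖f y‖ₑ := by
            rw [← lintegral_indicator hRm]
            refine lintegral_mono_ae ?_
            filter_upwards [hvf] with y hy
            by_cases hyR : y ∈ R
            · simp only [hyR, Set.indicator_of_mem, enorm_mul]
              gcongr
              exact hy k
            · have : v k y = 0 := by simp [v, hyR]
              simp [this]
        _ ≤ 2 * (2 * (2 * (4 * n : ℕ) + 1)) ^ n * ENNReal.ofReal (diniNorm ω) * a := by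
            refine lintegral_compl_dilate_mul_le hT.modulus hD (by omega) ha fun j y hy => ?_
            exact le_trans le_self_add (hT.enorm_kernel_sub_le hn hx hz j hy)
        _ = c := by
            simp only [c]
            push_cast
            ring
    calc ‖T (u k) x‖ₑ = ‖T (u k) z + (T (u k) x - T (u k) z)‖ₑ := by rw [add_sub_cancel]
      _ ≤ ‖T (u k) z‖ₑ + ‖T (u k) x - T (u k) z‖ₑ := enorm_add_le _ _
      _ ≤ _ := by gcongr
  exact le_of_tendsto_of_tendsto' hxN.2.enorm (hzN.2.enorm.add_const c) hk

end Extension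

/-! ### Selection of the descendants of a cube. -/

section SparseStep

variable {n : ℕ} {𝕜 : Type*} [RCLike 𝕜]

/-- Bounds for the averages over the dyadic cubes that make up a dilated cube carry over to the
average over the dilated cube. -/
lemma setLIntegral_dilate_le {m : ℕ} {q : ℤ × (Fin n → ℤ)}
    {φ : EuclideanSpace ℝ (Fin n) → ℝ≥0∞} {t : ℝ≥0∞}
    (h : ∀ y ∈ dilate m q, ∫⁻ x in dyadicCube (q.1, gridIndex q.1 y), φ x ≤
      t * volume (dyadicCube (q.1, gridIndex q.1 y))) :
    ∫⁻ x in dilate m q, φ x ≤ t * volume (dilate m q) := by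
  set J : Set (ℤ × (Fin n → ℤ)) := (fun y => (q.1, gridIndex q.1 y)) '' dilate m q with hJ
  have hJd : J.PairwiseDisjoint dyadicCube := by
    rintro p ⟨y, hy, rfl⟩ p' ⟨y', hy', rfl⟩ hne
    refine Set.disjoint_left.2 fun x hx hx' => hne ?_
    exact eq_of_mem_of_fst_eq hx hx' rfl
  have hU : dilate m q = ⋃ p ∈ J, dyadicCube p := by
    ext x
    constructor
    · intro hx
      exact Set.mem_iUnion₂.2 ⟨_, ⟨x, hx, rfl⟩, mem_dyadicCube_gridIndex _ _⟩
    · intro hx i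
      obtain ⟨_, ⟨y, hy, rfl⟩, hxy⟩ := Set.mem_iUnion₂.1 hx
      have : gridIndex q.1 x i = gridIndex q.1 y i := congrFun hxy i
      rw [this]
      exact hy i
  have hv : volume (dilate m q) = ∑' p : J, volume (dyadicCube (p : ℤ × (Fin n → ℤ))) := by
    rw [hU, measure_biUnion (Set.to_countable J) hJd fun p _ => measurableSet_dyadicCube p]
  rw [hv, ← ENNReal.tsum_mul_left, hU, ← tsum_setLIntegral_dyadicCube hJd]
  refine ENNReal.tsum_le_tsum ?_
  rintro ⟨p, y, hy, rfl⟩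
  exact h y hy

/-- If `w` lies in no dilated stopping cube, then the averages over all dilated dyadic cubes around
`w` are bounded. -/
lemma setLIntegral_dilate_le_of_notMem (hn : 0 < n) {m : ℕ} {q : ℤ × (Fin n → ℤ)}
    {φ : EuclideanSpace ℝ (Fin n) → ℝ≥0∞} {t : ℝ≥0∞} (ht : t ≠ 0) (hφ : ∫⁻ x, φ x ≠ ∞)
    {w : EuclideanSpace ℝ (Fin n)} (hwq : w ∈ dyadicCube q)
    (hw : ∀ p ∈ stoppingCubes φ t, w ∉ dilate m p) :
    ∫⁻ x in dilate m q, φ x ≤ t * volume (dilate m q) := by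
  refine setLIntegral_dilate_le fun y hy => not_lt.1 fun hheavy => ?_
  obtain ⟨i, hi⟩ := IsHeavy.exists_ancestor_mem_stoppingCubes hn ht hφ hheavy
  -- If a neighbouring cube were heavy, w would lie in its dilate, hence in the dilate of its
  -- stopping ancestor.
  refine hw _ hi (dilate_subset_ancestor m i _ ?_)
  exact dilate_symm (mem_dyadicCube_gridIndex q.1 y) hwq rfl hy

/-- The constant in the sparse step. -/
def stepConst (n : ℕ) : ℕ :=
  2 ^ (n + 4) * (8 * n + 1) ^ n * weakConst n +
    4 * weakConst n * 2 ^ (n + 4) * ((8 * n + 1) ^ n) ^ 3 +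
    2 * (2 * (8 * n + 1)) ^ n * 2 ^ (n + 4) * ((8 * n + 1) ^ n) ^ 2

variable {T : Lp 𝕜 2 (volume : Measure (EuclideanSpace ℝ (Fin n))) →L[𝕜]
    Lp 𝕜 2 (volume : Measure (EuclideanSpace ℝ (Fin n)))}
  {K : EuclideanSpace ℝ (Fin n) → EuclideanSpace ℝ (Fin n) → 𝕜} {CK : ℝ} {ω : ℝ → ℝ}

/-- This covers cubes with vanishing average, where all thresholds of the selection degenerate to 0.
-/
lemma IsL1Extension.ae_eq_zero {C : ℝ≥0∞} (hT : HasWeakType T C)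
    {f g : EuclideanSpace ℝ (Fin n) → 𝕜} (hg : IsL1Extension T f g) (hf : Integrable f)
    (h0 : ∫⁻ x, ‖f x‖ₑ = 0) : ∀ᵐ x, ‖g x‖ₑ = 0 := by
  have h : ∀ᵐ x, ∀ k : ℕ, ‖g x‖ₑ ≤ (k + 1 : ℝ≥0∞)⁻¹ := by
    refine ae_all_iff.2 fun k => ?_
    have h1 := hg.mul_volume_lt_enorm_le hT hf (k + 1 : ℝ≥0∞)⁻¹
    rw [h0, mul_zero, nonpos_iff_eq_zero, mul_eq_zero] at h1
    have h2 := h1.resolve_left (ENNReal.inv_ne_zero.2 (by finiteness))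
    rw [ae_iff]
    simpa only [not_le] using h2
  filter_upwards [h] with x hx
  refine nonpos_iff_eq_zero.1 (ge_of_tendsto' (x := atTop) ?_ hx)
  have := ENNReal.tendsto_inv_nat_nhds_zero.comp (tendsto_add_atTop_nat 1)
  simpa [Function.comp_def] using this

/-- The main step in sparse domination: the selection of the descendants of a dyadic cube. -/
theorem IsCalderonZygmund.exists_descendants (hT : IsCalderonZygmund T K CK ω)
    (hn : 0 < n) (hD : DiniCondition ω) {B : ℝ≥0∞} (hB0 : B ≠ 0) (hBt : B ≠ ∞)
    (hW : HasWeakType T (weakConst n * B)) (hDB : ENNReal.ofReal (diniNorm ω) ≤ B)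
    {f : EuclideanSpace ℝ (Fin n) → 𝕜} (hf : Integrable f)
    {G : ℤ × (Fin n → ℤ) → EuclideanSpace ℝ (Fin n) → 𝕜}
    (hG : ∀ q, IsL1Extension T ((dilate (4 * n) q).indicator f) (G q)) (q : ℤ × (Fin n → ℤ)) :
    ∃ ch : Set (ℤ × (Fin n → ℤ)), ch.PairwiseDisjoint dyadicCube ∧
      (∀ p ∈ ch, p.1 < q.1 ∧ dyadicCube p ⊆ dyadicCube q) ∧
      2 * ∑' p : ch, volume (dyadicCube (p : ℤ × (Fin n → ℤ))) ≤ volume (dyadicCube q) ∧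
      (∀ᵐ x, x ∈ dyadicCube q → (∀ p ∈ ch, x ∉ dyadicCube p) →
        ‖G q x‖ₑ ≤ stepConst n * B * ⨍⁻ y in dilate (4 * n) q, ‖f y‖ₑ ∂volume) ∧
      ∀ p ∈ ch, ∀ᵐ x, x ∈ dyadicCube p →
        ‖G q x‖ₑ ≤ stepConst n * B * (⨍⁻ y in dilate (4 * n) q, ‖f y‖ₑ ∂volume) + ‖G p x‖ₑ := by
  set v := volume (dyadicCube q) with hv
  have hv0 : v ≠ 0 := volume_dyadicCube_ne_zero q
  have hvt : v ≠ ∞ := volume_dyadicCube_ne_top q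
  set L : ℝ≥0∞ := (8 * n + 1) ^ n with hL
  have hL0 : L ≠ 0 := by positivity
  have hLt : L ≠ ∞ := ENNReal.pow_ne_top (by finiteness)
  have hvol : ∀ p : ℤ × (Fin n → ℤ), volume (dilate (4 * n) p) = L * volume (dyadicCube p) := by
    intro p
    rw [volume_dilate, hL]
    push_cast
    ring
  have hfi : ∀ p : ℤ × (Fin n → ℤ), Integrable ((dilate (4 * n) p).indicator f) := fun p =>
    hf.indicator (measurableSet_dilate _ p)
  have hfl : ∀ p : ℤ × (Fin n → ℤ), ∫⁻ x, ‖(dilate (4 * n) p).indicator f x‖ₑ =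
      ∫⁻ x in dilate (4 * n) p, ‖f x‖ₑ := by
    intro p
    rw [← lintegral_indicator (measurableSet_dilate _ p)]
    simp_rw [enorm_indicator_eq_indicator_enorm]
  set a := ⨍⁻ y in dilate (4 * n) q, ‖f y‖ₑ ∂volume with ha
  have hint : ∫⁻ x in dilate (4 * n) q, ‖f x‖ₑ = a * (L * v) := by
    rw [ha, setLAverage_eq, ← hvol, ENNReal.div_mul_cancel (volume_dilate_ne_zero _ q)
      (volume_dilate_ne_top _ q)]
  have hat : a ≠ ∞ := by
    rw [ha, setLAverage_eq]
    exact ENNReal.div_ne_top (ne_top_of_le_ne_top hf.2.ne (setLIntegral_le_lintegral _ _))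
      (volume_dilate_ne_zero _ q)
  rcases eq_or_ne a 0 with ha0 | ha0
  · refine ⟨∅, by simp, by simp, by simp, ?_, by simp⟩
    have h0 : ∫⁻ x, ‖(dilate (4 * n) q).indicator f x‖ₑ = 0 := by
      rw [hfl, hint, ha0, zero_mul]
    filter_upwards [(hG q).ae_eq_zero hW (hfi q) h0] with x hx _ _
    rw [hx]
    exact zero_le
  set W : ℝ≥0∞ := weakConst n * B with hWdef
  have hW0 : W ≠ 0 := by
    refine mul_ne_zero ?_ hB0
    have : 0 < weakConst n := by unfold weakConst; positivity
    exact_mod_cast this.ne'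
  have hWt : W ≠ ∞ := ENNReal.mul_ne_top (by simp) hBt
  -- With this κ, both E and D have measure at most v / κ. In t one factor L pays for dilating the
  -- stopping cubes and one for ∫ |f| = a L v over the dilate.
  set κ : ℝ≥0∞ := 2 ^ (n + 4) with hκ
  have hκ0 : κ ≠ 0 := by positivity
  have hκt : κ ≠ ∞ := by finiteness
  set s₁ : ℝ≥0∞ := κ * (L * W * a) with hs₁
  set t : ℝ≥0∞ := κ * L ^ 2 * a with ht
  have ht0 : t ≠ 0 := by positivity
  have htt : t ≠ ∞ := by finiteness
  -- the exceptional set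
  set E : Set (EuclideanSpace ℝ (Fin n)) := {x | s₁ < ‖G q x‖ₑ} with hE
  have hEv : κ * volume E ≤ v := by
    have h := (hG q).mul_volume_lt_enorm_le hW (hfi q) s₁
    rw [hfl, hint] at h
    have hc0 : L * W * a ≠ 0 := by positivity
    have hct : L * W * a ≠ ∞ := by finiteness
    rw [← ENNReal.mul_le_mul_iff_right hc0 hct]
    calc L * W * a * (κ * volume E) = s₁ * volume E := by rw [hs₁]; ring
      _ ≤ W * (a * (L * v)) := h
      _ = _ := by ring
  set φ : EuclideanSpace ℝ (Fin n) → ℝ≥0∞ := (dilate (4 * n) q).indicator fun x => ‖f x‖ₑ with hφ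
  have hφl : ∫⁻ x, φ x = a * (L * v) := by
    rw [hφ, lintegral_indicator (measurableSet_dilate _ q), hint]
  have hφt : ∫⁻ x, φ x ≠ ∞ := by
    rw [hφl]
    finiteness
  set D : Set (EuclideanSpace ℝ (Fin n)) := ⋃ p ∈ stoppingCubes φ t, dilate (4 * n) p with hDdef
  have hDv : κ * volume D ≤ v := by
    have h1 : volume D ≤ L * ∑' p : stoppingCubes φ t,
        volume (dyadicCube (p : ℤ × (Fin n → ℤ))) := by
      refine (measure_biUnion_le volume (Set.to_countable _) _).trans (le_of_eq ?_)
      rw [← ENNReal.tsum_mul_left]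
      exact tsum_congr fun p => hvol p
    have h2 := mul_tsum_volume_stoppingCubes_le φ t
    rw [hφl] at h2
    have hc0 : L * a ≠ 0 := by positivity
    have hct : L * a ≠ ∞ := by finiteness
    rw [← ENNReal.mul_le_mul_iff_right hc0 hct]
    calc L * a * (κ * volume D) ≤ L * a * (κ * (L * ∑' p : stoppingCubes φ t,
          volume (dyadicCube (p : ℤ × (Fin n → ℤ))))) := by gcongr
      _ = t * ∑' p : stoppingCubes φ t, volume (dyadicCube (p : ℤ × (Fin n → ℤ))) := by
          rw [ht]
          ring
      _ ≤ a * (L * v) := h2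
      _ = _ := by ring
  -- E need not be Borel, since G q is only almost everywhere strongly measurable; a measurable hull
  -- of the same measure replaces E ∪ D.
  set Ω : Set (EuclideanSpace ℝ (Fin n)) := toMeasurable volume (E ∪ D) ∩ dyadicCube q with hΩ
  have hΩm : MeasurableSet Ω :=
    (measurableSet_toMeasurable _ _).inter (measurableSet_dyadicCube q)
  have hΩsub : ∀ x ∈ dyadicCube q, x ∉ Ω → ‖G q x‖ₑ ≤ s₁ ∧ x ∉ D := by
    intro x hx hxΩ
    have h : x ∉ E ∪ D := fun h => hxΩ ⟨subset_toMeasurable _ _ h, hx⟩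
    exact ⟨not_lt.1 fun h' => h (Or.inl h'), fun h' => h (Or.inr h')⟩
  have hΩv : 2 ^ (n + 3) * volume Ω ≤ v := by
    have h1 : volume Ω ≤ volume E + volume D := by
      refine (measure_mono Set.inter_subset_left).trans ?_
      rw [measure_toMeasurable]
      exact measure_union_le _ _
    rw [← ENNReal.mul_le_mul_iff_right (a := 2) (by norm_num) (by norm_num)]
    calc 2 * (2 ^ (n + 3) * volume Ω) = κ * volume Ω := by rw [hκ]; ring
      _ ≤ κ * (volume E + volume D) := by gcongr
      _ = κ * volume E + κ * volume D := by ring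
      _ ≤ v + v := add_le_add hEv hDv
      _ = 2 * v := by ring
  set ψ : EuclideanSpace ℝ (Fin n) → ℝ≥0∞ := Ω.indicator 1 with hψ
  have hψs : ∀ s : Set (EuclideanSpace ℝ (Fin n)), ∫⁻ x in s, ψ x = volume (Ω ∩ s) := by
    intro s
    rw [hψ, lintegral_indicator_one hΩm, Measure.restrict_apply hΩm]
  have hψl : ∫⁻ x, ψ x = volume Ω := by
    rw [hψ, lintegral_indicator_one hΩm]
  -- Since |Ω| ≤ θ v / 2, the selected cubes have total measure at most v / 2; since 2 ^ n θ = 1/4,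
  -- Ω fills at most a quarter of each of them.
  set θ : ℝ≥0∞ := (2 ^ (n + 2))⁻¹ with hθ
  have hpow0 : (2 : ℝ≥0∞) ^ (n + 2) ≠ 0 := by positivity
  have hpowt : (2 : ℝ≥0∞) ^ (n + 2) ≠ ∞ := by finiteness
  have hθ0 : θ ≠ 0 := ENNReal.inv_ne_zero.2 hpowt
  have hθ1 : 2 ^ (n + 2) * θ = 1 := ENNReal.mul_inv_cancel hpow0 hpowt
  have hΩt : volume Ω ≠ ∞ := ne_top_of_le_ne_top hvt (measure_mono Set.inter_subset_right)
  set ch := stoppingCubes ψ θ with hch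
  have hchq : ∀ p ∈ ch, p.1 < q.1 ∧ dyadicCube p ⊆ dyadicCube q ∧
      dilate (4 * n) p ⊆ dilate (4 * n) q := by
    intro p hp
    have h1 : θ * volume (dyadicCube p) < volume (Ω ∩ dyadicCube p) := by
      have := hp.1
      rwa [IsHeavy, hψs] at this
    obtain ⟨x, hxΩ, hxp⟩ := nonempty_of_measure_ne_zero (ne_bot_of_gt h1)
    have hxq : x ∈ dyadicCube q := hxΩ.2
    have hlt : p.1 < q.1 := by
      -- A cube containing q has density of Ω at most θ, so it cannot be selected.
      by_contra hle
      rw [not_lt] at hle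
      refine absurd h1 (not_lt.2 ?_)
      have hsub : dyadicCube q ⊆ dyadicCube p := by
        rw [eq_ancestor_of_mem hxq hxp hle]
        exact dyadicCube_subset_ancestor _ _
      calc volume (Ω ∩ dyadicCube p) ≤ volume Ω := measure_mono Set.inter_subset_left
        _ = θ * (2 ^ (n + 2) * volume Ω) := by
            rw [← mul_assoc, mul_comm θ, hθ1, one_mul]
        _ ≤ θ * (2 ^ (n + 3) * volume Ω) := by
            gcongr
            · norm_num
            · omega
        _ ≤ θ * v := by gcongr
        _ ≤ θ * volume (dyadicCube p) := mul_le_mul_right (measure_mono hsub) θ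
    rw [eq_ancestor_of_mem hxp hxq hlt.le]
    exact ⟨by simpa only [← eq_ancestor_of_mem hxp hxq hlt.le] using hlt,
      dyadicCube_subset_ancestor _ _, dilate_subset_ancestor _ _ _⟩
  have hbase : stepConst n * B * a = s₁ + 4 * (W * (t * L)) +
      2 * (2 * (8 * n + 1)) ^ n * B * t := by
    rw [hs₁, ht, hWdef, hκ, hL]
    simp only [stepConst]
    push_cast
    ring
  refine ⟨ch, pairwiseDisjoint_stoppingCubes ψ θ, fun p hp => ⟨(hchq p hp).1, (hchq p hp).2.1⟩,
    ?_, ?_, ?_⟩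
  · have h1 := mul_tsum_volume_stoppingCubes_le ψ θ
    rw [hψl] at h1
    calc 2 * ∑' p : ch, volume (dyadicCube (p : ℤ × (Fin n → ℤ)))
        = 2 ^ (n + 3) * (θ * ∑' p : ch, volume (dyadicCube (p : ℤ × (Fin n → ℤ)))) := by
          rw [pow_succ, ← mul_assoc, mul_comm (2 ^ (n + 2)) (2 : ℝ≥0∞), mul_assoc 2, hθ1, mul_one]
      _ ≤ 2 ^ (n + 3) * volume Ω := by gcongr
      _ ≤ v := hΩv
  · filter_upwards [ae_le_of_notMem_stoppingCubes hn hθ0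
      ((measurable_one.indicator hΩm).aemeasurable) (hψl ▸ hΩt)] with x hx hxq hxch
    have h1 := hx hxch
    have hxΩ : x ∉ Ω := by
      intro hxΩ
      rw [Set.indicator_of_mem hxΩ, Pi.one_apply] at h1
      have h2 : (2 : ℝ≥0∞) ^ (n + 2) ≤ 1 := by
        calc (2 : ℝ≥0∞) ^ (n + 2) = 2 ^ (n + 2) * 1 := (mul_one _).symm
          _ ≤ 2 ^ (n + 2) * θ := by gcongr
          _ = 1 := hθ1
      have h3 : (1 : ℝ≥0∞) < 2 ^ (n + 2) := by
        exact_mod_cast Nat.one_lt_two_pow (n := n + 2) (by omega)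
      exact absurd h2 (not_le.2 h3)
    rw [hbase]
    exact (hΩsub x hxq hxΩ).1.trans (le_self_add.trans le_self_add)
  · intro p hp
    obtain ⟨-, hpq, hdpq⟩ := hchq p hp
    set vp := volume (dyadicCube p) with hvp
    have hvp0 : vp ≠ 0 := volume_dyadicCube_ne_zero p
    have hvpt : vp ≠ ∞ := volume_dyadicCube_ne_top p
    have hpΩ : 4 * volume (Ω ∩ dyadicCube p) ≤ vp := by
      have h := setLIntegral_le_of_mem_stoppingCubes hp
      rw [hψs] at h
      calc 4 * volume (Ω ∩ dyadicCube p) ≤ 4 * (2 ^ n * θ * vp) := by gcongr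
        _ = 2 ^ (n + 2) * θ * vp := by ring
        _ = vp := by rw [hθ1, one_mul]
    -- This single point lies in every ancestor of p and so controls all averages over their
    -- dilates.
    obtain ⟨w, hwp, hwΩ⟩ : ∃ w ∈ dyadicCube p, w ∉ Ω := by
      by_contra! hall
      have : Ω ∩ dyadicCube p = dyadicCube p := Set.inter_eq_right.2 hall
      rw [this] at hpΩ
      have h1 : vp < 4 * vp := by
        calc vp = 1 * vp := (one_mul _).symm
          _ < 4 * vp := by
            rw [ENNReal.mul_lt_mul_iff_left hvp0 hvpt]
            norm_num
      exact absurd hpΩ (not_le.2 h1)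
    have hwD : ∀ r ∈ stoppingCubes φ t, w ∉ dilate (4 * n) r := fun r hr h =>
      (hΩsub w (hpq hwp) hwΩ).2 (Set.mem_iUnion₂.2 ⟨r, hr, h⟩)
    have havg : ∀ j, ∫⁻ x in dilate (4 * n) (ancestor j p), φ x ≤
        t * volume (dilate (4 * n) (ancestor j p)) := fun j =>
      setLIntegral_dilate_le_of_notMem hn ht0 hφt (mem_ancestor j hwp) hwD
    -- the part of `f` away from the cube `p`
    set h : EuclideanSpace ℝ (Fin n) → 𝕜 :=
      (dilate (4 * n) q \ dilate (4 * n) p).indicator f with hh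
    have hhi : Integrable h :=
      hf.indicator ((measurableSet_dilate _ q).diff (measurableSet_dilate _ p))
    obtain ⟨g, hg⟩ := hW.exists_isL1Extension hWt hhi
    have hsplit : (dilate (4 * n) q).indicator f = h + (dilate (4 * n) p).indicator f := by
      funext x
      simp only [hh, Pi.add_apply]
      by_cases hxp : x ∈ dilate (4 * n) p
      · simp [hxp, hdpq hxp]
      · by_cases hxq : x ∈ dilate (4 * n) q <;> simp [hxp, hxq]
    have hsum : ∀ᵐ x, G q x = g x + G p x :=
      hg.add_ae_eq (hG p) (hsplit ▸ hG q) hhi (hfi p)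
    obtain ⟨N, hN0, hN⟩ := hT.ae_enorm_extension_le (q := p) hD hn hhi hg
      (fun y hy => by simp [hh, hy]) (a := t) fun j => by
        refine le_trans (lintegral_mono fun x => ?_) (havg j)
        simp only [hh, hφ]
        by_cases hxq : x ∈ dilate (4 * n) q
        · simp only [hxq, Set.indicator_of_mem]
          rw [enorm_le_iff_norm_le]
          exact norm_indicator_le_norm_self _ _
        · simp [hxq]
    -- The factor 4 makes the level set of G p at most a quarter of p.
    set s₂ : ℝ≥0∞ := 4 * (W * (t * L)) with hs₂
    have hGp : 4 * volume {x | s₂ < ‖G p x‖ₑ} ≤ vp := by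
      have h1 := (hG p).mul_volume_lt_enorm_le hW (hfi p) s₂
      have h2 : ∫⁻ x, ‖(dilate (4 * n) p).indicator f x‖ₑ ≤ t * (L * vp) := by
        rw [hfl, ← hvol]
        have := havg 0
        rw [ancestor_zero] at this
        refine le_trans (le_of_eq ?_) this
        refine setLIntegral_congr_fun (measurableSet_dilate _ p) fun x hx => ?_
        simp [hφ, hdpq hx]
      have hc0 : W * (t * L) ≠ 0 := by positivity
      have hct : W * (t * L) ≠ ∞ := by finiteness
      rw [← ENNReal.mul_le_mul_iff_right hc0 hct]
      calc W * (t * L) * (4 * volume {x | s₂ < ‖G p x‖ₑ}) = s₂ * volume {x | s₂ < ‖G p x‖ₑ} := by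
            rw [hs₂]
            ring
        _ ≤ W * (t * (L * vp)) := h1.trans (mul_le_mul_right h2 W)
        _ = _ := by ring
    obtain ⟨Z, hZ0, hZ⟩ : ∃ Z : Set (EuclideanSpace ℝ (Fin n)), volume Z = 0 ∧
        ∀ x ∉ Z, G q x = g x + G p x := ⟨_, ae_iff.1 hsum, fun x hx => not_not.1 hx⟩
    -- Two bad sets of at most a quarter of p each, and two null sets, cannot cover p.
    obtain ⟨z, hzp, hzbad⟩ : ∃ z ∈ dyadicCube p,
        z ∉ (Ω ∩ dyadicCube p) ∪ ({x | s₂ < ‖G p x‖ₑ} ∪ (N ∪ Z)) := by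
      by_contra! hall
      have h1 : vp ≤ volume (Ω ∩ dyadicCube p) + volume {x | s₂ < ‖G p x‖ₑ} := by
        refine (measure_mono hall).trans ((measure_union_le _ _).trans ?_)
        refine add_le_add le_rfl ((measure_union_le _ _).trans (le_of_eq ?_))
        rw [measure_union_null hN0 hZ0, add_zero]
      have h2 : 4 * vp ≤ 2 * vp := by
        calc 4 * vp ≤ 4 * (volume (Ω ∩ dyadicCube p) + volume {x | s₂ < ‖G p x‖ₑ}) := by gcongr
          _ = 4 * volume (Ω ∩ dyadicCube p) + 4 * volume {x | s₂ < ‖G p x‖ₑ} := by ring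
          _ ≤ vp + vp := add_le_add hpΩ hGp
          _ = 2 * vp := by ring
      rw [ENNReal.mul_le_mul_iff_left hvp0 hvpt] at h2
      norm_num at h2
    simp only [Set.mem_union, Set.mem_inter_iff, not_or, Set.mem_ofPred_eq, not_lt] at hzbad
    obtain ⟨hzΩ, hzG, hzN, hzZ⟩ := hzbad
    have hzq : ‖G q z‖ₑ ≤ s₁ := (hΩsub z (hpq hzp) fun h => hzΩ ⟨h, hzp⟩).1
    have hgz : ‖g z‖ₑ ≤ s₁ + s₂ := by
      have : g z = G q z - G p z := by rw [hZ z hzZ, add_sub_cancel_right]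
      rw [this]
      exact enorm_sub_le.trans (add_le_add hzq hzG)
    have hN' : ∀ᵐ x, x ∉ N := measure_eq_zero_iff_ae_notMem.1 hN0
    filter_upwards [hsum, hN'] with x hx hxN hxp
    calc ‖G q x‖ₑ ≤ ‖g x‖ₑ + ‖G p x‖ₑ := by
          rw [hx]
          exact enorm_add_le _ _
      _ ≤ (s₁ + s₂) + 2 * (2 * (8 * n + 1)) ^ n * B * t + ‖G p x‖ₑ := by
          gcongr
          refine (hN x ⟨hxp, hxN⟩ z ⟨hzp, hzN⟩).trans ?_
          gcongr
      _ = _ := by rw [hbase]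

end SparseStep

/-! ### Generations of cubes, sparseness and the initial partition. -/

section Assembly

variable {n : ℕ}

/-- The generations of cubes obtained from the cubes `R` by iterating the selection `ch`. -/
def generation (R : Set (ℤ × (Fin n → ℤ))) (ch : ℤ × (Fin n → ℤ) → Set (ℤ × (Fin n → ℤ))) :
    ℕ → Set (ℤ × (Fin n → ℤ))
  | 0 => R
  | k + 1 => ⋃ q ∈ generation R ch k, ch q

/-- A selection of pairwise disjoint dyadic subcubes of every dyadic cube, of at most half the
total measure. -/
structure IsSelection (ch : ℤ × (Fin n → ℤ) → Set (ℤ × (Fin n → ℤ))) : Prop where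
  disjoint : ∀ q, (ch q).PairwiseDisjoint dyadicCube
  lt : ∀ q, ∀ p ∈ ch q, p.1 < q.1
  subset : ∀ q, ∀ p ∈ ch q, dyadicCube p ⊆ dyadicCube q
  volume_le : ∀ q, 2 * ∑' p : ch q, volume (dyadicCube (p : ℤ × (Fin n → ℤ))) ≤
    volume (dyadicCube q)

variable {R : Set (ℤ × (Fin n → ℤ))} {ch : ℤ × (Fin n → ℤ) → Set (ℤ × (Fin n → ℤ))}

lemma pairwiseDisjoint_generation (hch : IsSelection ch) (hR : R.PairwiseDisjoint dyadicCube)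
    (k : ℕ) : (generation R ch k).PairwiseDisjoint dyadicCube := by
  induction k with
  | zero => exact hR
  | succ k ih =>
    intro p hp p' hp' hne
    obtain ⟨q, hq, hpq⟩ := Set.mem_iUnion₂.1 hp
    obtain ⟨q', hq', hpq'⟩ := Set.mem_iUnion₂.1 hp'
    by_cases h : q = q'
    · subst h
      exact hch.disjoint q hpq hpq' hne
    · exact (ih hq hq' h).mono (hch.subset q p hpq) (hch.subset q' p' hpq')

/-- The union of the cubes of a generation. -/
def generationUnion (R : Set (ℤ × (Fin n → ℤ)))
    (ch : ℤ × (Fin n → ℤ) → Set (ℤ × (Fin n → ℤ))) (k : ℕ) : Set (EuclideanSpace ℝ (Fin n)) :=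
  ⋃ q ∈ generation R ch k, dyadicCube q

lemma antitone_generationUnion (hch : IsSelection ch) : Antitone (generationUnion R ch) := by
  refine antitone_nat_of_succ_le fun k x hx => ?_
  obtain ⟨p, hp, hxp⟩ := Set.mem_iUnion₂.1 hx
  obtain ⟨q, hq, hpq⟩ := Set.mem_iUnion₂.1 hp
  exact Set.mem_iUnion₂.2 ⟨q, hq, hch.subset q p hpq hxp⟩

/-- Cubes of one generation are disjoint, so the parent of the cube around x must be q. -/
lemma exists_mem_descendants (hch : IsSelection ch) (hR : R.PairwiseDisjoint dyadicCube) {k : ℕ}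
    {q : ℤ × (Fin n → ℤ)} (hq : q ∈ generation R ch k) {x : EuclideanSpace ℝ (Fin n)}
    (hxq : x ∈ dyadicCube q) (hx : x ∈ generationUnion R ch (k + 1)) :
    ∃ p ∈ ch q, x ∈ dyadicCube p := by
  obtain ⟨p, hp, hxp⟩ := Set.mem_iUnion₂.1 hx
  obtain ⟨r, hr, hpr⟩ := Set.mem_iUnion₂.1 hp
  have : r = q := by
    by_contra hne
    exact Set.disjoint_left.1 (pairwiseDisjoint_generation hch hR k hr hq hne)
      (hch.subset r p hpr hxp) hxq
  exact ⟨p, this ▸ hpr, hxp⟩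

/-- Each generation halves the measure inside a cube. The generation j varies in the induction,
since the hypothesis is applied to the children of q. -/
lemma volume_inter_generationUnion_le (hch : IsSelection ch)
    (hR : R.PairwiseDisjoint dyadicCube) (k : ℕ) :
    ∀ (j : ℕ), ∀ q ∈ generation R ch j,
      2 ^ k * volume (dyadicCube q ∩ generationUnion R ch (j + k)) ≤ volume (dyadicCube q) := by
  induction k with
  | zero =>
    intro j q _
    rw [pow_zero, one_mul]
    exact measure_mono Set.inter_subset_left
  | succ k ih =>
    intro j q hq
    have hsub : dyadicCube q ∩ generationUnion R ch (j + (k + 1)) ⊆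
        ⋃ p ∈ ch q, dyadicCube p ∩ generationUnion R ch (j + 1 + k) := by
      rintro x ⟨hxq, hx⟩
      obtain ⟨p, hp, hxp⟩ := exists_mem_descendants hch hR hq hxq
        (antitone_generationUnion hch (by omega) hx)
      refine Set.mem_iUnion₂.2 ⟨p, hp, hxp, ?_⟩
      rwa [show j + 1 + k = j + (k + 1) by omega]
    calc 2 ^ (k + 1) * volume (dyadicCube q ∩ generationUnion R ch (j + (k + 1)))
        ≤ 2 ^ (k + 1) * ∑' p : ch q, volume (dyadicCube (p : ℤ × (Fin n → ℤ)) ∩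
            generationUnion R ch (j + 1 + k)) := by
          gcongr
          exact (measure_mono hsub).trans (measure_biUnion_le volume (Set.to_countable _) _)
      _ = 2 * ∑' p : ch q, 2 ^ k * volume (dyadicCube (p : ℤ × (Fin n → ℤ)) ∩
            generationUnion R ch (j + 1 + k)) := by
          rw [ENNReal.tsum_mul_left]
          ring
      _ ≤ 2 * ∑' p : ch q, volume (dyadicCube (p : ℤ × (Fin n → ℤ))) := by
          gcongr with p
          exact ih (j + 1) p (Set.mem_iUnion₂.2 ⟨q, hq, p.2⟩)
      _ ≤ _ := hch.volume_le q

/-- Almost every point lies in only finitely many generations. -/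
lemma ae_exists_notMem_generationUnion (hch : IsSelection ch)
    (hR : R.PairwiseDisjoint dyadicCube) : ∀ᵐ x, ∃ N, x ∉ generationUnion R ch N := by
  have h : ∀ q ∈ R, ∀ᵐ x, x ∈ dyadicCube q → ∃ N, x ∉ generationUnion R ch N := by
    intro q hq
    have h0 : volume (dyadicCube q ∩ ⋂ N, generationUnion R ch N) = 0 := by
      have hle : ∀ k : ℕ, volume (dyadicCube q ∩ ⋂ N, generationUnion R ch N) ≤
          volume (dyadicCube q) * (2⁻¹) ^ k := by
        intro k
        have h1 := volume_inter_generationUnion_le hch hR k 0 q hq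
        rw [← ENNReal.inv_pow, ← div_eq_mul_inv, ENNReal.le_div_iff_mul_le (Or.inl (by positivity))
          (Or.inl (by finiteness)), mul_comm]
        refine le_trans ?_ h1
        gcongr
        exact Set.iInter_subset _ _
      have hlim : Tendsto (fun k : ℕ => volume (dyadicCube q) * (2⁻¹ : ℝ≥0∞) ^ k) atTop (𝓝 0) := by
        have := ENNReal.Tendsto.const_mul (a := volume (dyadicCube q))
          (ENNReal.tendsto_pow_atTop_nhds_zero_of_lt_one (r := 2⁻¹) (by simp))
          (Or.inr (volume_dyadicCube_ne_top q))
        rwa [mul_zero] at this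
      exact nonpos_iff_eq_zero.1 (ge_of_tendsto' hlim hle)
    filter_upwards [measure_eq_zero_iff_ae_notMem.1 h0] with x hx hxq
    by_contra! hall
    exact hx ⟨hxq, Set.mem_iInter.2 hall⟩
  have h' := (ae_ball_iff (Set.to_countable R)).2 h
  filter_upwards [h'] with x hx
  by_cases h0 : x ∈ generationUnion R ch 0
  · obtain ⟨q, hq, hxq⟩ := Set.mem_iUnion₂.1 h0
    exact hx q hq hxq
  · exact ⟨0, h0⟩

/-- The dilates of all cubes of all generations form a sparse family. -/
lemma isSparse_generation (hn : 0 < n) (m : ℕ) (hch : IsSelection ch)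
    (hR : R.PairwiseDisjoint dyadicCube) :
    IsSparse (1 / (2 * (2 * m + 1) ^ n)) (dilate m '' ⋃ k, generation R ch k) := by
  -- These sets lie in the undilated cubes, at least half of each; the factor (2m+1)^n in the
  -- sparseness constant pays for the dilation.
  set E : ℤ × (Fin n → ℤ) → Set (EuclideanSpace ℝ (Fin n)) := fun q =>
    dyadicCube q \ ⋃ p ∈ ch q, dyadicCube p with hE
  have hinj := dilate_injective hn m
  have hUm : ∀ q, MeasurableSet (⋃ p ∈ ch q, dyadicCube p) := fun q =>
    MeasurableSet.biUnion (Set.to_countable _) fun p _ => measurableSet_dyadicCube p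
  have hEv : ∀ q, volume (dyadicCube q) ≤ 2 * volume (E q) := by
    intro q
    have hUv : 2 * volume (⋃ p ∈ ch q, dyadicCube p) ≤ volume (dyadicCube q) := by
      refine le_trans ?_ (hch.volume_le q)
      gcongr
      exact measure_biUnion_le volume (Set.to_countable _) _
    have h1 : volume (dyadicCube q) ≤ volume (E q) + volume (⋃ p ∈ ch q, dyadicCube p) := by
      refine le_trans (measure_mono ?_) (measure_union_le _ _)
      rw [hE, Set.sdiff_union_self]
      exact Set.subset_union_left
    have h2 : volume (dyadicCube q) + volume (dyadicCube q) ≤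
        2 * volume (E q) + volume (dyadicCube q) := by
      calc _ = 2 * volume (dyadicCube q) := (two_mul _).symm
        _ ≤ 2 * (volume (E q) + volume (⋃ p ∈ ch q, dyadicCube p)) := by gcongr
        _ = 2 * volume (E q) + 2 * volume (⋃ p ∈ ch q, dyadicCube p) := mul_add _ _ _
        _ ≤ _ := by gcongr
    exact (ENNReal.add_le_add_iff_right (volume_dyadicCube_ne_top q)).1 h2
  have hEd : ∀ q q' x, q ∈ ⋃ k, generation R ch k → q' ∈ ⋃ k, generation R ch k →
      x ∈ E q → x ∈ E q' → q = q' := by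
    have key : ∀ q q' x i j, i ≤ j → q ∈ generation R ch i → q' ∈ generation R ch j →
        x ∈ E q → x ∈ E q' → q = q' := by
      intro q q' x i j hij hq hq' hx hx'
      rcases hij.eq_or_lt with rfl | hlt
      · by_contra hne
        exact Set.disjoint_left.1 (pairwiseDisjoint_generation hch hR i hq hq' hne) hx.1 hx'.1
      · have hxU : x ∈ generationUnion R ch j := Set.mem_iUnion₂.2 ⟨q', hq', hx'.1⟩
        obtain ⟨p, hp, hxp⟩ := exists_mem_descendants hch hR hq hx.1
          (antitone_generationUnion hch hlt hxU)
        exact absurd (Set.mem_iUnion₂.2 ⟨p, hp, hxp⟩) hx.2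
    intro q q' x hq hq' hx hx'
    obtain ⟨i, hi⟩ := Set.mem_iUnion.1 hq
    obtain ⟨j, hj⟩ := Set.mem_iUnion.1 hq'
    rcases le_total i j with h | h
    · exact key q q' x i j h hi hj hx hx'
    · exact (key q' q x j i h hj hi hx' hx).symm
  -- Sparseness is indexed by sets, so E is transported along the injective `dilate m`; its value ∅
  -- elsewhere plays no role.
  refine ⟨?_, Function.extend (dilate m) E fun _ => ∅, ?_, ?_⟩
  · rintro _ ⟨q, _, rfl⟩
    exact isCube_dilate m q
  · rintro _ ⟨q, _, rfl⟩
    rw [hinj.extend_apply]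
    refine ⟨(measurableSet_dyadicCube q).diff (hUm q),
      Set.sdiff_subset.trans (dyadicCube_subset_dilate m q), ?_⟩
    have hr : (0 : ℝ) < 2 * (2 * m + 1) ^ n := by positivity
    have e : ENNReal.ofReal (1 / (2 * (2 * m + 1) ^ n)) = (2 * (2 * (m : ℝ≥0∞) + 1) ^ n)⁻¹ := by
      rw [one_div, ENNReal.ofReal_inv_of_pos hr]
      congr 1
      have : (2 * (2 * (m : ℝ) + 1) ^ n) = ((2 * (2 * m + 1) ^ n : ℕ) : ℝ) := by push_cast; rfl
      rw [this, ENNReal.ofReal_natCast]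
      push_cast
      rfl
    have hc0 : 2 * (2 * (m : ℝ≥0∞) + 1) ^ n ≠ 0 := by positivity
    have hct : 2 * (2 * (m : ℝ≥0∞) + 1) ^ n ≠ ∞ := by finiteness
    rw [e, mul_comm, ← div_eq_mul_inv, ENNReal.div_le_iff hc0 hct, volume_dilate]
    calc (2 * (m : ℝ≥0∞) + 1) ^ n * volume (dyadicCube q)
        ≤ (2 * (m : ℝ≥0∞) + 1) ^ n * (2 * volume (E q)) := by
          gcongr
          exact hEv q
      _ = _ := by ring
  · rintro _ ⟨q, hq, rfl⟩ _ ⟨q', hq', rfl⟩ hne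
    rw [Function.onFun, hinj.extend_apply, hinj.extend_apply]
    refine Set.disjoint_left.2 fun x hx hx' => hne ?_
    rw [hEd q q' x hq hq' hx hx']

/-- Iteration of the estimates for a cube and its descendants. -/
lemma enorm_le_mul_sparseOperator {E : Type*} [NormedAddCommGroup E] (hn : 0 < n) (m : ℕ)
    (hch : IsSelection ch) {G : ℤ × (Fin n → ℤ) → E} {C : ℝ≥0∞}
    {φ : EuclideanSpace ℝ (Fin n) → ℝ≥0∞} {x : EuclideanSpace ℝ (Fin n)}
    (h₁ : ∀ q, x ∈ dyadicCube q → (∀ p ∈ ch q, x ∉ dyadicCube p) →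
      ‖G q‖ₑ ≤ C * ⨍⁻ y in dilate m q, φ y ∂volume)
    (h₂ : ∀ q, ∀ p ∈ ch q, x ∈ dyadicCube p →
      ‖G q‖ₑ ≤ C * (⨍⁻ y in dilate m q, φ y ∂volume) + ‖G p‖ₑ)
    {N : ℕ} (hN : x ∉ generationUnion R ch N) {q : ℤ × (Fin n → ℤ)} (hq : q ∈ R)
    (hxq : x ∈ dyadicCube q) :
    ‖G q‖ₑ ≤ C * sparseOperator (dilate m '' ⋃ k, generation R ch k) φ x := by
  classical
  set J := ⋃ k, generation R ch k with hJ
  -- The bound on scales shows that q is new when it is added to the chain below it, so no average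
  -- is counted twice. The case i = 0 is vacuous by `hN`.
  have key : ∀ (i k : ℕ), k + i = N → ∀ q ∈ generation R ch k, x ∈ dyadicCube q →
      ∃ F : Finset (ℤ × (Fin n → ℤ)), (∀ p ∈ F, p ∈ J ∧ p.1 ≤ q.1 ∧ x ∈ dyadicCube p) ∧
        ‖G q‖ₑ ≤ C * ∑ p ∈ F, ⨍⁻ y in dilate m p, φ y ∂volume := by
    intro i
    induction i with
    | zero =>
      intro k hk q hq hxq
      have hx : x ∈ generationUnion R ch k := Set.mem_iUnion₂.2 ⟨q, hq, hxq⟩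
      rw [add_zero] at hk
      exact absurd (hk ▸ hx) hN
    | succ i ih =>
      intro k hk q hq hxq
      have hqJ : q ∈ J := Set.mem_iUnion.2 ⟨k, hq⟩
      by_cases hp : ∃ p ∈ ch q, x ∈ dyadicCube p
      · obtain ⟨p, hp, hxp⟩ := hp
        obtain ⟨F, hF, hFG⟩ := ih (k + 1) (by omega) p (Set.mem_iUnion₂.2 ⟨q, hq, hp⟩) hxp
        have hlt := hch.lt q p hp
        have hqF : q ∉ F := fun h => absurd (hF q h).2.1 (not_le.2 hlt)
        refine ⟨insert q F, fun r hr => ?_, ?_⟩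
        · rcases Finset.mem_insert.1 hr with rfl | hr
          · exact ⟨hqJ, le_rfl, hxq⟩
          · exact ⟨(hF r hr).1, (hF r hr).2.1.trans hlt.le, (hF r hr).2.2⟩
        · rw [Finset.sum_insert hqF, mul_add]
          exact (h₂ q p hp hxp).trans (by gcongr)
      · push Not at hp
        refine ⟨{q}, fun r hr => ?_, ?_⟩
        · rw [Finset.mem_singleton] at hr
          subst hr
          exact ⟨hqJ, le_rfl, hxq⟩
        · rw [Finset.sum_singleton]
          exact h₁ q hxq hp
  obtain ⟨F, hF, hFG⟩ := key N 0 (zero_add N) q hq hxq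
  refine hFG.trans ?_
  gcongr
  set ψ : Set (EuclideanSpace ℝ (Fin n)) → ℝ≥0∞ := fun Q =>
    Q.indicator (fun _ => ⨍⁻ y in Q, φ y ∂volume) x with hψ
  have e : sparseOperator (dilate m '' J) φ x = ∑' Q, (dilate m '' J).indicator ψ Q :=
    tsum_subtype (dilate m '' J) ψ
  rw [e]
  calc ∑ p ∈ F, ⨍⁻ y in dilate m p, φ y ∂volume
      = ∑ p ∈ F, (dilate m '' J).indicator ψ (dilate m p) := by
        refine Finset.sum_congr rfl fun p hp => ?_
        rw [Set.indicator_of_mem (Set.mem_image_of_mem _ (hF p hp).1)]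
        simp only [hψ]
        rw [Set.indicator_of_mem (dyadicCube_subset_dilate m p (hF p hp).2.2)]
    _ = ∑ Q ∈ F.image (dilate m), (dilate m '' J).indicator ψ Q :=
        (Finset.sum_image fun p _ p' _ h => dilate_injective hn m h).symm
    _ ≤ _ := ENNReal.sum_le_tsum _

/-- A partition of `ℝⁿ` into dyadic cubes whose dilates contain a given ball. -/
lemma exists_dyadic_partition (r : ℝ) {m : ℕ} (hm : 3 ≤ m) :
    ∃ R : Set (ℤ × (Fin n → ℤ)), R.PairwiseDisjoint dyadicCube ∧
      (∀ x, ∃ q ∈ R, x ∈ dyadicCube q) ∧ ∀ q ∈ R, Metric.closedBall 0 r ⊆ dilate m q := by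
  classical
  obtain ⟨k₀, hk₀⟩ := pow_unbounded_of_one_lt r (one_lt_two : (1 : ℝ) < 2)
  -- The partition takes the smallest cube around x with this property. The indices -2, ..., 1 form
  -- two full pairs of siblings, so at scales at least k₀ the property depends only on the parent
  -- cube; hence chosen cubes coincide or are disjoint.
  let P : EuclideanSpace ℝ (Fin n) → ℕ → Prop := fun x s =>
    k₀ ≤ s ∧ ∀ i, -2 ≤ gridIndex s x i ∧ gridIndex s x i ≤ 1
  have hstep : ∀ (x : EuclideanSpace ℝ (Fin n)) (s : ℕ) i,
      gridIndex ((s + 1 : ℕ) : ℤ) x i = gridIndex s x i / 2 := by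
    intro x s i
    have := gridIndex_add s 1 x i
    simpa using this
  have hmono : ∀ x s s', s ≤ s' → P x s → P x s' := by
    intro x s s' hss h
    induction s', hss using Nat.le_induction with
    | base => exact h
    | succ s' hs ih =>
      refine ⟨ih.1.trans (Nat.le_succ _), fun i => ?_⟩
      rw [hstep]
      have := ih.2 i
      omega
  have hball : ∀ (x : EuclideanSpace ℝ (Fin n)) (s : ℕ), ‖x‖ ≤ 2 ^ s →
      ∀ i, -1 ≤ gridIndex s x i ∧ gridIndex s x i ≤ 1 := by
    intro x s hx i
    have h1 : |x i| ≤ 2 ^ s := by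
      have := abs_apply_sub_le_norm x 0 i
      simp only [PiLp.zero_apply, sub_zero] at this
      exact this.trans hx
    rw [abs_le] at h1
    have hpos : (0 : ℝ) < 2 ^ s := by positivity
    constructor
    · rw [gridIndex, Int.le_floor, zpow_natCast, le_div_iff₀ hpos]
      push_cast
      linarith
    · rw [gridIndex, ← Int.lt_add_one_iff, Int.floor_lt, zpow_natCast, div_lt_iff₀ hpos]
      push_cast
      linarith
  have hex : ∀ x, ∃ s, P x s := by
    intro x
    obtain ⟨s, hs⟩ := pow_unbounded_of_one_lt ‖x‖ (one_lt_two : (1 : ℝ) < 2)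
    refine ⟨max s k₀, le_max_right _ _, fun i => ?_⟩
    have hle : (2 : ℝ) ^ s ≤ 2 ^ max s k₀ := by
      gcongr
      · norm_num
      · exact le_max_left _ _
    have := hball x (max s k₀) (hs.le.trans hle) i
    exact ⟨by linarith [this.1], this.2⟩
  let σ : EuclideanSpace ℝ (Fin n) → ℕ := fun x => Nat.find (hex x)
  have hσ : ∀ x, P x (σ x) := fun x => Nat.find_spec (hex x)
  have hσle : ∀ x s, P x s → σ x ≤ s := fun x s h => Nat.find_min' (hex x) h
  have hσeq : ∀ x z, z ∈ dyadicCube ((σ x : ℤ), gridIndex (σ x) x) → σ z = σ x := by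
    intro x z hz
    have hz' : gridIndex (σ x) z = gridIndex (σ x) x := hz
    have hPz : P z (σ x) := by
      refine ⟨(hσ x).1, fun i => ?_⟩
      rw [hz']
      exact (hσ x).2 i
    refine le_antisymm (hσle z _ hPz) (not_lt.1 fun hlt => ?_)
    obtain ⟨s, hs⟩ := Nat.exists_eq_succ_of_ne_zero (Nat.ne_zero_of_lt hlt)
    have hPzs : P z s := hmono z (σ z) s (by omega) (hσ z)
    have : P x s := by
      refine ⟨hPzs.1, fun i => ?_⟩
      have h1 := hPzs.2 i
      have h2 : gridIndex ((s + 1 : ℕ) : ℤ) z i = gridIndex ((s + 1 : ℕ) : ℤ) x i := by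
        have := congrFun hz' i
        rwa [hs] at this
      rw [hstep, hstep] at h2
      omega
    have := hσle x s this
    omega
  refine ⟨Set.range fun x => ((σ x : ℤ), gridIndex (σ x) x), ?_, fun x =>
    ⟨_, ⟨x, rfl⟩, mem_dyadicCube_gridIndex _ _⟩, ?_⟩
  · rintro _ ⟨x, rfl⟩ _ ⟨y, rfl⟩ hne
    refine Set.disjoint_left.2 fun z hzx hzy => hne ?_
    refine eq_of_mem_of_fst_eq hzx hzy ?_
    simp only
    rw [← hσeq x z hzx, ← hσeq y z hzy]
  · rintro _ ⟨x, rfl⟩ y hy i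
    rw [mem_closedBall_zero_iff] at hy
    have hle : (2 : ℝ) ^ k₀ ≤ 2 ^ σ x := by
      gcongr
      · norm_num
      · exact (hσ x).1
    have h1 := hball y (σ x) (hy.trans (hk₀.le.trans hle)) i
    have h2 := (hσ x).2 i
    simp only
    rw [abs_le]
    -- Ball indices lie in [-1, 1] and cube indices in [-2, 1], so they differ by at most 3.
    have : (3 : ℤ) ≤ m := by exact_mod_cast hm
    constructor <;> linarith

end Assembly

/-! ### Sparse domination. -/

theorem theorem3p1 (n : ℕ) (hn : 0 < n) :
    ∃ c η : ℝ, 0 < c ∧ 0 < η ∧ η < 1 ∧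
      ∀ (𝕜 : Type*) [RCLike 𝕜]
        (T : Lp 𝕜 2 (volume : Measure (EuclideanSpace ℝ (Fin n))) →L[𝕜]
          Lp 𝕜 2 (volume : Measure (EuclideanSpace ℝ (Fin n))))
        (K : EuclideanSpace ℝ (Fin n) → EuclideanSpace ℝ (Fin n) → 𝕜)
        (CK : ℝ) (ω : ℝ → ℝ),
        IsCalderonZygmund T K CK ω → DiniCondition ω →
        ∀ f : EuclideanSpace ℝ (Fin n) → 𝕜, Integrable f volume → HasCompactSupport f →
          (∃ Tf : EuclideanSpace ℝ (Fin n) → 𝕜, IsL1Extension T f Tf) ∧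
          ∀ Tf : EuclideanSpace ℝ (Fin n) → 𝕜, IsL1Extension T f Tf →
            ∃ S : Set (Set (EuclideanSpace ℝ (Fin n))), IsSparse η S ∧
              ∀ᵐ x ∂volume, ‖Tf x‖ₑ ≤
                ENNReal.ofReal (c * (‖T‖ + CK + diniNorm ω)) *
                  sparseOperator S (fun y => ‖f y‖ₑ) x := by
  have hstep : 0 < stepConst n := by unfold stepConst weakConst; positivity
  refine ⟨stepConst n, 1 / (2 * (2 * (4 * n : ℕ) + 1) ^ n), by exact_mod_cast hstep,
    by positivity, ?_, ?_⟩
  · rw [div_lt_one (by positivity)]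
    have : (1 : ℝ) ≤ (2 * (4 * n : ℕ) + 1) ^ n :=
      one_le_pow₀ (by linarith [Nat.cast_nonneg (α := ℝ) (4 * n)])
    linarith
  intro 𝕜 _ T K CK ω hT hD f hf hfc
  have hdini := diniNorm_nonneg hT.modulus
  have hCK : 0 ≤ CK := by
    have hne : (EuclideanSpace.single ⟨0, hn⟩ (1 : ℝ) : EuclideanSpace ℝ (Fin n)) ≠ 0 := by
      simp
    have h := (norm_nonneg _).trans (hT.size _ _ hne)
    by_contra hneg
    have := div_neg_of_neg_of_pos (not_le.1 hneg) (pow_pos (norm_pos_iff.2 (sub_ne_zero.2 hne)) n)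
    linarith
  set b : ℝ := ‖T‖ + CK + diniNorm ω with hb
  have hb0 : 0 ≤ b := by positivity
  have hTb : ∀ B : ℝ, b ≤ B → ‖T‖ₑ ≤ ENNReal.ofReal B := by
    intro B hB
    rw [← ofReal_norm]
    exact ENNReal.ofReal_le_ofReal (by linarith)
  have hDb : ∀ B : ℝ, b ≤ B → ENNReal.ofReal (diniNorm ω) ≤ ENNReal.ofReal B := fun B hB =>
    ENNReal.ofReal_le_ofReal (by linarith [norm_nonneg T])
  have hweak : ∀ B : ℝ, 0 < B → b ≤ B → HasWeakType T (weakConst n * ENNReal.ofReal B) :=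
    fun B hB0 hB u hu s => hT.weak_type hn hD (ENNReal.ofReal_pos.2 hB0).ne'
      ENNReal.ofReal_ne_top (hTb B hB) (hDb B hB) u hu s
  -- The weak type inequality requires a positive constant, and b may be 0; b + 1 is enough for
  -- existence.
  have hex : ∀ h : EuclideanSpace ℝ (Fin n) → 𝕜, Integrable h → ∃ g, IsL1Extension T h g :=
    fun h hh => (hweak (b + 1) (by linarith) (by linarith)).exists_isL1Extension
      (ENNReal.mul_ne_top (by simp) ENNReal.ofReal_ne_top) hh
  refine ⟨hex f hf, fun Tf hTf => ?_⟩
  -- If b = 0 then T = 0, and the empty family works.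
  rcases hb0.eq_or_lt with hb0 | hbpos
  · have hT0 : T = 0 := by
      rw [← norm_eq_zero]
      linarith [norm_nonneg T]
    refine ⟨∅, ⟨by simp, fun _ => ∅, by simp, by simp⟩, ?_⟩
    obtain ⟨u, -, -, -, hlim⟩ := hTf.exists_seq hf
    have h0 : ∀ᵐ x, ∀ k, T (u k) x = 0 := by
      refine ae_all_iff.2 fun k => ?_
      rw [hT0]
      exact Lp.coeFn_zero 𝕜 2 volume
    filter_upwards [hlim, h0] with x h1 h2
    simp_rw [h2] at h1
    rw [tendsto_nhds_unique h1 tendsto_const_nhds, enorm_zero]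
    exact zero_le
  have hfi : ∀ q : ℤ × (Fin n → ℤ), Integrable ((dilate (4 * n) q).indicator f) := fun q =>
    hf.indicator (measurableSet_dilate _ q)
  choose G hG using fun q => hex _ (hfi q)
  choose ch hch₁ hch₂ hch₃ hch₄ hch₅ using
    hT.exists_descendants hn hD (ENNReal.ofReal_pos.2 hbpos).ne' ENNReal.ofReal_ne_top
      (hweak b hbpos le_rfl) (hDb b le_rfl) hf hG
  have hch : IsSelection ch :=
    ⟨hch₁, fun q p hp => (hch₂ q p hp).1, fun q p hp => (hch₂ q p hp).2, hch₃⟩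
  obtain ⟨r, hr⟩ := hfc.isCompact.isBounded.subset_closedBall 0
  obtain ⟨R, hR, hcover, hRball⟩ := exists_dyadic_partition (n := n) r (m := 4 * n) (by omega)
  refine ⟨dilate (4 * n) '' ⋃ k, generation R ch k, isSparse_generation hn (4 * n) hch hR, ?_⟩
  -- The dilate of every root cube contains the support of f, so the cutoff does nothing.
  have hroot : ∀ q ∈ R, ∀ᵐ x, Tf x = G q x := by
    intro q hq
    have e : (dilate (4 * n) q).indicator f = f := by
      rw [Set.indicator_eq_self]
      exact (subset_tsupport f).trans (hr.trans (hRball q hq))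
    exact hTf.ae_eq (e ▸ hG q) hf
  filter_upwards [ae_all_iff.2 hch₄,
    ae_all_iff.2 fun q => (ae_ball_iff (Set.to_countable (ch q))).2 (hch₅ q),
    ae_exists_notMem_generationUnion hch hR,
    (ae_ball_iff (Set.to_countable R)).2 hroot] with x h1 h2 h3 h4
  obtain ⟨N, hN⟩ := h3
  obtain ⟨q, hq, hxq⟩ := hcover x
  rw [h4 q hq, ENNReal.ofReal_mul (by positivity), ENNReal.ofReal_natCast]
  exact enorm_le_mul_sparseOperator (G := fun q => G q x) hn (4 * n) hch h1 h2 hN hq hxq
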